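/- Let $a,d,e\in\mathbb R$ with $d>0$ be such that $P(x,y)=xy^2+ay-dx-e$ is irreducible in $\mathbb R[x,y]$, let $C=\{(x,y)\in\mathbb R^2: P(x,y)=0\}$ with vanishing ideal $I\subset\mathbb R[x,y]$, and let $\mathbb R[C]=\mathbb R[x,y]/I$, with $\mathbb R[C]_{\le m}$ the image of the polynomials $\mathbb R[x,y]_{\le m}$ of degree at most $m$. Let $k\ge 1$ and, in $\mathbb R[C]$, put $$\mathcal B_k=\{x^k,x^{k-1},x^{k-1}y,\dots,x,xy,1,y,\dots,y^k\},\qquad \widetilde{\mathcal B}_k=\{x^ky,x^{k-1},x^{k-1}y,\dots,x,xy,1,y,\dots,y^k\},$$ and $V^{(k)}=\operatorname{Lin}\widetilde{\mathcal B}_k$. (Then $\mathcal B_k$ is a basis of $\mathbb R[C]_{\le k}$, and products of two elements of $V^{(k)}$ lie in $\mathbb R[C]_{\le 2k}$.) Let $L:\mathbb R[x,y]_{\le 2k}\to\mathbb R$ be a linear functional that vanishes on $I\cap\mathbb R[x,y]_{\le 2k}$, and let $L_C:\mathbb R[C]_{\le 2k}\to\mathbb R$, $L_C(f+I)=L(f)$.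 Let $\overline L$, $\overline L_C$ and $\overline L_{C,V^{(k)},1}$ be the bilinear forms $(f,g)\mapsto L(fg)$ on $\mathbb R[x,y]_{\le k}$, and $(f,g)\mapsto L_C(fg)$ on $\mathbb R[C]_{\le k}$ and on $V^{(k)}$, respectively. Assume that $L$ is $C$-singular, that is, $\ker\overline L\ne I\cap\mathbb R[x,y]_{\le k}$ or $\ker\overline L_{C,V^{(k)},1}\neq\{0\}$. For $n\ge 0$ let $\mathcal L(nD)=\{q/(t^2-d)^n: q\in\mathbb R[t],\ \deg q\le 3n\}\subset\mathbb R(t)$; this is the Riemann–Roch space of $nD$, where $D=Q_{\sqrt d}+Q_{-\sqrt d}+Q_\infty$ is the sum of the points $\sqrt d,-\sqrt d,\infty$ of $\mathbb P^1$. A *square positive extension* of $L$ is a linear functional $\widehat L:\mathcal L(2kD)\to\mathbb R$ with $\widehat L\big(p\big(\tfrac{-at+e}{t^2-d},t\big)\big)=L(p)$ for all $p\in\mathbb R[x,y]_{\le 2k}$ and $\widehat L(f^2)\ge 0$ for all $f\in\mathcal L(kD)$. It induces the univariate functional $\ell:\mathbb R[t]_{\le 6k}\to\mathbb R$, $\ell(f)=\widehat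 L\big(f/(t^2-d)^{2k}\big)$; a *generating polynomial* of $\ell$ is a nonzero polynomial of lowest degree in the kernel of the form $(f,g)\mapsto\ell(fg)$ on $\mathbb R[t]_{\le 3k}$ (it is unique up to a scalar factor, if it exists). Then the following are equivalent: 1. $L$ is a $C$-moment functional: there is a positive Borel measure $\mu$ supported on $C$ such that every $p\in\mathbb R[x,y]_{\le 2k}$ is $\mu$-integrable and $L(p)=\int_C p\,d\mu$. 2. $L_C$ is square positive ($L_C(f^2)\ge0$ for all $f\in\mathbb R[C]_{\le k}$) and $(V^{(k)},1)$-locally square positive ($L_C(g^2)\ge 0$ for all $g\in V^{(k)}$); there is a square positive extension $\widehat L$ of $L$ for which the generating polynomial of the induced functional $\ell$ exists and $\sqrt d$, $-\sqrt d$ are not zeros of it; and one of the following holds: (a) $\operatorname{rank}\overline L_C=\operatorname{rank}\big(\overline L_C|_U\big)$ for $U=\operatorname{Lin}(\mathcal B_k\setminus\{y^k\})$; (b) $\operatorname{rank}\overline L_{C,V^{(k)},1}=\operatorname{rank}\big(\overline L_{C,V^{(k)},1}|_W\big)$ for $W=\operatorname{Lin}(\widetilde{\mathcal B}_k\setminus\{y^k\})$.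 3. The same as 2, with "there is a square positive extension $\widehat L$ of $L$ for which" replaced by "for every square positive extension $\widehat L$ of $L$,". -/

import Mathlib

noncomputable section

namespace CubicTMP

/-! ### Bilinear forms -/

/-- The form `(f, g) ↦ L (f * g)` on a subspace `V` of an algebra, for a linear functional `L`
on a subspace `U` which contains all products of two elements of `V`. -/
def mulForm {A : Type*} [CommRing A] [Algebra ℝ A] (V U : Submodule ℝ A)
    (h : ∀ f ∈ V, ∀ g ∈ V, f * g ∈ U) (L : U →ₗ[ℝ] ℝ) : LinearMap.BilinForm ℝ V :=
  LinearMap.mk₂ ℝ (fun f g => L ⟨(f : A) * (g : A), h f f.2 g g.2⟩)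
    (fun f₁ f₂ g => by
      rw [← map_add]; congr 1; ext; simp [add_mul])
    (fun c f g => by
      rw [← map_smul]; congr 1; ext; simp)
    (fun f g₁ g₂ => by
      rw [← map_add]; congr 1; ext; simp [mul_add])
    (fun c f g => by
      rw [← map_smul]; congr 1; ext; simp)

/-- `B (v, v) ≥ 0` for all `v`. -/
def IsPos {V : Type*} [AddCommMonoid V] [Module ℝ V] (B : LinearMap.BilinForm ℝ V) : Prop :=
  ∀ v : V, 0 ≤ B v v

/-- The rank of a bilinear form (on a finite-dimensional space). -/
def formRank {V : Type*} [AddCommMonoid V] [Module ℝ V] (B : LinearMap.BilinForm ℝ V) : ℕ :=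
  Module.finrank ℝ (LinearMap.range B)

/-! ### Plane curves, their coordinate rings, and functionals on polynomials -/

/-- `ℝ[x,y]_{≤ m}`. -/
abbrev polyDeg (m : ℕ) : Submodule ℝ (MvPolynomial (Fin 2) ℝ) :=
  MvPolynomial.restrictTotalDegree (Fin 2) ℝ m

/-- `L` is a `K`-moment functional: it is integration against a (positive) Borel measure on the
plane which is carried by `K`. -/
def IsMomentFunctional (K : Set (Fin 2 → ℝ)) {m : ℕ} (L : polyDeg m →ₗ[ℝ] ℝ) : Prop :=
  ∃ μ : MeasureTheory.Measure (Fin 2 → ℝ), μ Kᶜ = 0 ∧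
    ∀ p : polyDeg m,
      MeasureTheory.Integrable (fun z => MvPolynomial.eval z (p : MvPolynomial (Fin 2) ℝ)) μ ∧
      L p = ∫ z, MvPolynomial.eval z (p : MvPolynomial (Fin 2) ℝ) ∂μ

/-- `ℝ[K] = ℝ[x,y] / I`, where `I` is the vanishing ideal of `K`. -/
abbrev CoordRing (K : Set (Fin 2 → ℝ)) : Type :=
  MvPolynomial (Fin 2) ℝ ⧸ MvPolynomial.vanishingIdeal ℝ K

/-- The restriction map `ℝ[x,y]_{≤ m} → ℝ[K]`. -/
def toCoord (K : Set (Fin 2 → ℝ)) (m : ℕ) : polyDeg m →ₗ[ℝ] CoordRing K :=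
  (Ideal.Quotient.mkₐ ℝ (MvPolynomial.vanishingIdeal ℝ K)).toLinearMap ∘ₗ (polyDeg m).subtype

/-- `ℝ[K]_{≤ m}`, the image of `ℝ[x,y]_{≤ m}`. -/
def coordDeg (K : Set (Fin 2 → ℝ)) (m : ℕ) : Submodule ℝ (CoordRing K) :=
  LinearMap.range (toCoord K m)

/-- `L` vanishes on `I_{≤ m} = I ∩ ℝ[x,y]_{≤ m}`; equivalently, `L_K` is well defined. -/
def VanishesOnIdeal (K : Set (Fin 2 → ℝ)) {m : ℕ} (L : polyDeg m →ₗ[ℝ] ℝ) : Prop :=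
  ∀ p : polyDeg m, (p : MvPolynomial (Fin 2) ℝ) ∈ MvPolynomial.vanishingIdeal ℝ K → L p = 0

theorem toCoord_eq_zero_iff (K : Set (Fin 2 → ℝ)) (m : ℕ) (p : polyDeg m) :
    toCoord K m p = 0 ↔
      (p : MvPolynomial (Fin 2) ℝ) ∈ MvPolynomial.vanishingIdeal ℝ K := by
  simp [toCoord, Ideal.Quotient.eq_zero_iff_mem]

theorem ker_toCoord_le (K : Set (Fin 2 → ℝ)) {m : ℕ} (L : polyDeg m →ₗ[ℝ] ℝ)
    (hL : VanishesOnIdeal K L) : LinearMap.ker (toCoord K m) ≤ LinearMap.ker L :=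
  fun p hp => LinearMap.mem_ker.2 (hL p ((toCoord_eq_zero_iff K m p).1 (LinearMap.mem_ker.1 hp)))

/-- The induced functional `L_K : ℝ[K]_{≤ m} → ℝ`, `L_K (f + I) = L f`. -/
def inducedFunctional (K : Set (Fin 2 → ℝ)) {m : ℕ} (L : polyDeg m →ₗ[ℝ] ℝ)
    (hL : VanishesOnIdeal K L) : coordDeg K m →ₗ[ℝ] ℝ :=
  ((LinearMap.ker (toCoord K m)).liftQ L (ker_toCoord_le K L hL)) ∘ₗ
    (toCoord K m).quotKerEquivRange.symm.toLinearMap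

theorem inducedFunctional_apply (K : Set (Fin 2 → ℝ)) {m : ℕ} (L : polyDeg m →ₗ[ℝ] ℝ)
    (hL : VanishesOnIdeal K L) (p : polyDeg m) :
    inducedFunctional K L hL ⟨toCoord K m p, LinearMap.mem_range_self _ p⟩ = L p := by
  have h : (toCoord K m).quotKerEquivRange.symm
      ⟨toCoord K m p, LinearMap.mem_range_self _ p⟩ =
      (LinearMap.ker (toCoord K m)).mkQ p :=
    (toCoord K m).quotKerEquivRange_symm_apply_image p (LinearMap.mem_range_self _ p)
  change (LinearMap.ker (toCoord K m)).liftQ L (ker_toCoord_le K L hL)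
    ((toCoord K m).quotKerEquivRange.symm ⟨toCoord K m p, LinearMap.mem_range_self _ p⟩) = L p
  exact (congrArg _ h).trans (Submodule.liftQ_apply _ _ _)

theorem mk_mem_coordDeg (K : Set (Fin 2 → ℝ)) {m : ℕ} (p : MvPolynomial (Fin 2) ℝ)
    (hp : p.totalDegree ≤ m) :
    Ideal.Quotient.mk (MvPolynomial.vanishingIdeal ℝ K) p ∈ coordDeg K m :=
  ⟨⟨p, (MvPolynomial.mem_restrictTotalDegree _ _ _).2 hp⟩, rfl⟩

theorem mem_coordDeg (K : Set (Fin 2 → ℝ)) {m : ℕ} {f : CoordRing K} (hf : f ∈ coordDeg K m) :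
    ∃ p : MvPolynomial (Fin 2) ℝ, p.totalDegree ≤ m ∧
      Ideal.Quotient.mk (MvPolynomial.vanishingIdeal ℝ K) p = f := by
  obtain ⟨p, rfl⟩ := hf
  exact ⟨p, (MvPolynomial.mem_restrictTotalDegree _ _ _).1 p.2, rfl⟩

theorem polyDeg_mul (k : ℕ) : ∀ f ∈ polyDeg k, ∀ g ∈ polyDeg k, f * g ∈ polyDeg (2 * k) := by
  intro f hf g hg
  rw [MvPolynomial.mem_restrictTotalDegree] at *
  exact (MvPolynomial.totalDegree_mul f g).trans (by omega)

theorem coordDeg_mul_mem (K : Set (Fin 2 → ℝ)) {m n : ℕ} {f g : CoordRing K}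
    (hf : f ∈ coordDeg K m) (hg : g ∈ coordDeg K n) : f * g ∈ coordDeg K (m + n) := by
  obtain ⟨p, hp, rfl⟩ := mem_coordDeg K hf
  obtain ⟨q, hq, rfl⟩ := mem_coordDeg K hg
  rw [← map_mul]
  exact mk_mem_coordDeg K _ ((MvPolynomial.totalDegree_mul p q).trans (by omega))

theorem coordDeg_mono (K : Set (Fin 2 → ℝ)) {m n : ℕ} (h : m ≤ n) :
    coordDeg K m ≤ coordDeg K n := by
  intro f hf
  obtain ⟨p, hp, rfl⟩ := mem_coordDeg K hf
  exact mk_mem_coordDeg K _ (hp.trans h)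

theorem coordDeg_mul (K : Set (Fin 2 → ℝ)) (k : ℕ) :
    ∀ f ∈ coordDeg K k, ∀ g ∈ coordDeg K k, f * g ∈ coordDeg K (2 * k) := by
  intro f hf g hg
  rw [two_mul]
  exact coordDeg_mul_mem K hf hg

/-- The form `(f, g) ↦ L (f g)` on `ℝ[x,y]_{≤ k}`. -/
def polyForm {k : ℕ} (L : polyDeg (2 * k) →ₗ[ℝ] ℝ) : LinearMap.BilinForm ℝ (polyDeg k) :=
  mulForm (polyDeg k) (polyDeg (2 * k)) (polyDeg_mul k) L

/-- The form `(f, g) ↦ L_K (f g)` on `ℝ[K]_{≤ k}`. -/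
def coordForm (K : Set (Fin 2 → ℝ)) {k : ℕ} (L : polyDeg (2 * k) →ₗ[ℝ] ℝ)
    (hL : VanishesOnIdeal K L) : LinearMap.BilinForm ℝ (coordDeg K k) :=
  mulForm (coordDeg K k) (coordDeg K (2 * k)) (coordDeg_mul K k) (inducedFunctional K L hL)

/-! ### The cubic `x y² + a y - d x - e = 0` -/

/-- `x y² + a y - d x - e`. -/
def cubic (a d e : ℝ) : MvPolynomial (Fin 2) ℝ :=
  MvPolynomial.X 0 * MvPolynomial.X 1 ^ 2 + MvPolynomial.C a * MvPolynomial.X 1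
    - MvPolynomial.C d * MvPolynomial.X 0 - MvPolynomial.C e

/-- The real zero set of the cubic. -/
def curve (a d e : ℝ) : Set (Fin 2 → ℝ) := {z | MvPolynomial.eval z (cubic a d e) = 0}

/-- The coordinate function `x` on the curve. -/
def cx (a d e : ℝ) : CoordRing (curve a d e) := Ideal.Quotient.mk _ (MvPolynomial.X 0)

/-- The coordinate function `y` on the curve. -/
def cy (a d e : ℝ) : CoordRing (curve a d e) := Ideal.Quotient.mk _ (MvPolynomial.X 1)

/-- `{x^k, x^(k-1), x^(k-1) y, …, x, x y, 1, y, …, y^k}`, a basis of `ℝ[C]_{≤ k}`. -/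
def basisB (a d e : ℝ) (k : ℕ) : Set (CoordRing (curve a d e)) :=
  {cx a d e ^ k} ∪
    {f | ∃ j, 1 ≤ j ∧ j < k ∧ (f = cx a d e ^ j ∨ f = cx a d e ^ j * cy a d e)} ∪
    {f | ∃ l, l ≤ k ∧ f = cy a d e ^ l}

/-- `{x^k y, x^(k-1), x^(k-1) y, …, x, x y, 1, y, …, y^k}`. -/
def basisBt (a d e : ℝ) (k : ℕ) : Set (CoordRing (curve a d e)) :=
  {cx a d e ^ k * cy a d e} ∪
    {f | ∃ j, 1 ≤ j ∧ j < k ∧ (f = cx a d e ^ j ∨ f = cx a d e ^ j * cy a d e)} ∪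
    {f | ∃ l, l ≤ k ∧ f = cy a d e ^ l}

/-- `V^(k)`, the span of `x^k y, x^(k-1), x^(k-1) y, …, x, x y, 1, y, …, y^k`. -/
def spaceV (a d e : ℝ) (k : ℕ) : Submodule ℝ (CoordRing (curve a d e)) :=
  Submodule.span ℝ (basisBt a d e k)

theorem cx_mul_cy_sq (a d e : ℝ) :
    cx a d e * cy a d e ^ 2 = Ideal.Quotient.mk _
      (MvPolynomial.C d * MvPolynomial.X 0 + MvPolynomial.C e
        - MvPolynomial.C a * MvPolynomial.X 1) := by
  unfold cx cy
  rw [← map_pow, ← map_mul, Ideal.Quotient.eq, MvPolynomial.mem_vanishingIdeal_iff]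
  intro z hz
  have h : MvPolynomial.eval z (cubic a d e) = 0 := hz
  simp only [cubic, map_sub, map_add, map_mul, map_pow, MvPolynomial.eval_X,
    MvPolynomial.eval_C] at h
  simp only [map_sub, map_add, map_mul, map_pow, MvPolynomial.aeval_X,
    MvPolynomial.aeval_C, Algebra.algebraMap_self, RingHom.id_apply]
  linarith

theorem monomial_mem (a d e : ℝ) {i j m : ℕ} (h : i + j ≤ m) :
    cx a d e ^ i * cy a d e ^ j ∈ coordDeg (curve a d e) m := by
  unfold cx cy
  rw [← map_pow, ← map_pow, ← map_mul]
  refine mk_mem_coordDeg _ _ ((MvPolynomial.totalDegree_mul _ _).trans ?_)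
  rw [MvPolynomial.totalDegree_X_pow, MvPolynomial.totalDegree_X_pow]
  exact h

theorem monomial_mem' (a d e : ℝ) {i j m : ℕ} (h : i + j + 1 ≤ m) :
    cx a d e ^ (i + 1) * cy a d e ^ (j + 2) ∈ coordDeg (curve a d e) m := by
  have h1 : cx a d e ^ (i + 1) * cy a d e ^ (j + 2) =
      (cx a d e ^ i * cy a d e ^ j) * (cx a d e * cy a d e ^ 2) := by ring
  rw [h1, cx_mul_cy_sq]
  refine coordDeg_mono _ h (coordDeg_mul_mem _ (monomial_mem a d e le_rfl) ?_)
  apply mk_mem_coordDeg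
  have hX : ∀ (c : ℝ) (i : Fin 2),
      (MvPolynomial.C c * MvPolynomial.X i : MvPolynomial (Fin 2) ℝ).totalDegree ≤ 1 := by
    intro c i
    refine (MvPolynomial.totalDegree_mul _ _).trans ?_
    simp
  refine (MvPolynomial.totalDegree_sub _ _).trans (max_le ?_ (hX _ _))
  refine (MvPolynomial.totalDegree_add _ _).trans (max_le (hX _ _) ?_)
  simp

/-- A generator of `V^(k)` is the top one or lies in `ℝ[C]_{≤ k}`. -/
theorem basisBt_cases (a d e : ℝ) (k : ℕ) {f : CoordRing (curve a d e)}
    (hf : f ∈ basisBt a d e k) :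
    ∃ i j, f = cx a d e ^ i * cy a d e ^ j ∧
      ((i = k ∧ j = 1) ∨ (i < k ∧ j ≤ 1 ∧ i + j ≤ k) ∨ (i = 0 ∧ j ≤ k)) := by
  rcases hf with (hf | ⟨j, h1, h2, hf | hf⟩) | ⟨l, h1, hf⟩
  · exact ⟨k, 1, by simpa using hf, by omega⟩
  · exact ⟨j, 0, by simpa using hf, by omega⟩
  · exact ⟨j, 1, by simpa using hf, by omega⟩
  · exact ⟨0, l, by simpa using hf, by omega⟩

theorem spaceV_mul (a d e : ℝ) {k : ℕ} (hk : 1 ≤ k) :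
    ∀ f ∈ spaceV a d e k, ∀ g ∈ spaceV a d e k, f * g ∈ coordDeg (curve a d e) (2 * k) := by
  intro f hf g hg
  have key : spaceV a d e k * spaceV a d e k ≤ coordDeg (curve a d e) (2 * k) := by
    unfold spaceV
    rw [Submodule.span_mul_span, Submodule.span_le]
    rintro _ ⟨f, hf, g, hg, rfl⟩
    obtain ⟨i, j, rfl, h1⟩ := basisBt_cases a d e k hf
    obtain ⟨i', j', rfl, h2⟩ := basisBt_cases a d e k hg
    have h3 : (cx a d e ^ i * cy a d e ^ j) * (cx a d e ^ i' * cy a d e ^ j') =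
        cx a d e ^ (i + i') * cy a d e ^ (j + j') := by ring
    change (cx a d e ^ i * cy a d e ^ j) * (cx a d e ^ i' * cy a d e ^ j') ∈ _
    rw [h3]
    by_cases h4 : 1 ≤ i + i' ∧ 2 ≤ j + j'
    · obtain ⟨u, hu⟩ := Nat.exists_eq_add_of_le' h4.1
      obtain ⟨v, hv⟩ := Nat.exists_eq_add_of_le' h4.2
      rw [hu, hv]
      exact monomial_mem' a d e (by omega)
    · exact monomial_mem a d e (by omega)
  exact key (Submodule.mul_mem_mul hf hg)

/-- The local form `(g, h) ↦ L_C (1 · g h)` on `V^(k)`. -/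
def localForm (a d e : ℝ) {k : ℕ} (hk : 1 ≤ k) (L : polyDeg (2 * k) →ₗ[ℝ] ℝ)
    (hL : VanishesOnIdeal (curve a d e) L) : LinearMap.BilinForm ℝ (spaceV a d e k) :=
  mulForm (spaceV a d e k) (coordDeg (curve a d e) (2 * k)) (spaceV_mul a d e hk)
    (inducedFunctional (curve a d e) L hL)

/-- `L` is nonsingular for the curve: the kernel of `(f, g) ↦ L (f g)` on `ℝ[x,y]_{≤ k}` is
`I_{≤ k}`, and the local form on `V^(k)` has trivial kernel. -/
def IsNonsingular (a d e : ℝ) {k : ℕ} (hk : 1 ≤ k) (L : polyDeg (2 * k) →ₗ[ℝ] ℝ)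
    (hL : VanishesOnIdeal (curve a d e) L) : Prop :=
  (∀ f : polyDeg k, f ∈ LinearMap.ker (polyForm L) ↔
    (f : MvPolynomial (Fin 2) ℝ) ∈ MvPolynomial.vanishingIdeal ℝ (curve a d e)) ∧
  LinearMap.ker (localForm a d e hk L hL) = ⊥

/-! ### Rational functions on the line -/

/-- The polynomial `t² - d`. -/
def h2 (d : ℝ) : Polynomial ℝ := Polynomial.X ^ 2 - Polynomial.C d

theorem h2_monic (d : ℝ) : (h2 d).Monic := by
  unfold h2; monicity!

theorem h2_natDegree (d : ℝ) : (h2 d).natDegree = 2 := by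
  unfold h2; compute_degree!

theorem h2_ne_zero (d : ℝ) : h2 d ≠ 0 := (h2_monic d).ne_zero

theorem h2_intDegree_pow (d : ℝ) (n : ℕ) :
    (algebraMap (Polynomial ℝ) (RatFunc ℝ) (h2 d ^ n)).intDegree = 2 * n := by
  rw [RatFunc.intDegree_polynomial, Polynomial.natDegree_pow, h2_natDegree]
  push_cast; ring

/-- Membership in the space below: `f = q / (t² - d)^n` with `deg q ≤ 3 n`. -/
theorem rr_mem_iff (d : ℝ) (n : ℕ) (f : RatFunc ℝ) :
    (f.denom ∣ h2 d ^ n ∧ f.intDegree ≤ n) ↔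
      ∃ q : Polynomial ℝ, q.natDegree ≤ 3 * n ∧
        f = algebraMap _ _ q / algebraMap _ _ (h2 d ^ n) := by
  have hne : algebraMap (Polynomial ℝ) (RatFunc ℝ) (h2 d ^ n) ≠ 0 :=
    RatFunc.algebraMap_ne_zero (pow_ne_zero _ (h2_ne_zero d))
  rw [RatFunc.denom_dvd (pow_ne_zero _ (h2_ne_zero d))]
  have hdeg : ∀ q : Polynomial ℝ,
      (algebraMap (Polynomial ℝ) (RatFunc ℝ) q / algebraMap _ _ (h2 d ^ n)).intDegree ≤ n ↔
        q.natDegree ≤ 3 * n := by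
    intro q
    by_cases hq : q = 0
    · subst hq; simp
    · rw [RatFunc.intDegree_div (RatFunc.algebraMap_ne_zero hq) hne, h2_intDegree_pow,
        RatFunc.intDegree_polynomial]
      omega
  constructor
  · rintro ⟨⟨q, rfl⟩, h⟩
    exact ⟨q, (hdeg q).1 h, rfl⟩
  · rintro ⟨q, hq, rfl⟩
    exact ⟨⟨q, rfl⟩, (hdeg q).2 hq⟩

/-- The Riemann–Roch space `𝓛(n D)` on the projective line for the divisor
`D = Q_{√d} + Q_{-√d} + Q_∞`, `d > 0`: the rational functions whose only finite poles are `√d` and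
`-√d`, each of order at most `n`, and whose order of pole at infinity is at most `n`. -/
def rrSpace (d : ℝ) (n : ℕ) : Submodule ℝ (RatFunc ℝ) where
  carrier := {f | f.denom ∣ h2 d ^ n ∧ f.intDegree ≤ n}
  zero_mem' := by simp
  add_mem' := by
    intro f g hf hg
    obtain ⟨p, hp, rfl⟩ := (rr_mem_iff d n f).1 hf
    obtain ⟨q, hq, rfl⟩ := (rr_mem_iff d n g).1 hg
    refine (rr_mem_iff d n _).2 ⟨p + q, (Polynomial.natDegree_add_le _ _).trans (max_le hp hq), ?_⟩
    rw [map_add, add_div]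
  smul_mem' := by
    intro c f hf
    obtain ⟨p, hp, rfl⟩ := (rr_mem_iff d n f).1 hf
    refine (rr_mem_iff d n _).2 ⟨c • p, (Polynomial.natDegree_smul_le _ _).trans hp, ?_⟩
    rw [← smul_div_assoc, RatFunc.smul_eq_C_smul, Polynomial.smul_eq_C_mul, map_mul]
    simp [RatFunc.algebraMap_C, Algebra.smul_def]

theorem mem_rrSpace (d : ℝ) (n : ℕ) (f : RatFunc ℝ) :
    f ∈ rrSpace d n ↔ ∃ q : Polynomial ℝ, q.natDegree ≤ 3 * n ∧
        f = algebraMap _ _ q / algebraMap _ _ (h2 d ^ n) := rr_mem_iff d n f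

theorem rrSpace_mul_mem (d : ℝ) {m n : ℕ} {f g : RatFunc ℝ}
    (hf : f ∈ rrSpace d m) (hg : g ∈ rrSpace d n) : f * g ∈ rrSpace d (m + n) := by
  obtain ⟨p, hp, rfl⟩ := (mem_rrSpace d m f).1 hf
  obtain ⟨q, hq, rfl⟩ := (mem_rrSpace d n g).1 hg
  refine (mem_rrSpace d _ _).2 ⟨p * q, Polynomial.natDegree_mul_le.trans (by omega), ?_⟩
  rw [div_mul_div_comm, ← map_mul, ← map_mul, pow_add]

theorem rrSpace_mul (d : ℝ) (k : ℕ) :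
    ∀ f ∈ rrSpace d k, ∀ g ∈ rrSpace d k, f * g ∈ rrSpace d (2 * k) := by
  intro f hf g hg
  rw [two_mul]
  exact rrSpace_mul_mem d hf hg

theorem rrSpace_mono (d : ℝ) {m n : ℕ} (h : m ≤ n) : rrSpace d m ≤ rrSpace d n := by
  intro f hf
  exact ⟨hf.1.trans (pow_dvd_pow _ h), hf.2.trans (by exact_mod_cast h)⟩

/-- The form `(f, g) ↦ L̂ (f g)` on `𝓛(k D)`, for a functional `L̂` on `𝓛(2k D)`. -/
def rrForm (d : ℝ) {k : ℕ} (Lhat : rrSpace d (2 * k) →ₗ[ℝ] ℝ) :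
    LinearMap.BilinForm ℝ (rrSpace d k) :=
  mulForm (rrSpace d k) (rrSpace d (2 * k)) (rrSpace_mul d k) Lhat

/-- `h₃ = (- a t + e) / (t² - d)`. -/
def h3 (a d e : ℝ) : RatFunc ℝ :=
  algebraMap (Polynomial ℝ) (RatFunc ℝ) (-(Polynomial.C a * Polynomial.X) + Polynomial.C e) /
    algebraMap (Polynomial ℝ) (RatFunc ℝ) (h2 d)

/-- Pullback along the parametrization `t ↦ (h₃(t), t)` of the curve: `p(x, y) ↦ p(h₃(t), t)`. -/
def pullback (a d e : ℝ) : MvPolynomial (Fin 2) ℝ →ₐ[ℝ] RatFunc ℝ :=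
  MvPolynomial.aeval ![h3 a d e, RatFunc.X]

theorem h3_mem (a d e : ℝ) : h3 a d e ∈ rrSpace d 1 := by
  refine (mem_rrSpace d 1 _).2 ⟨-(Polynomial.C a * Polynomial.X) + Polynomial.C e, ?_, ?_⟩
  · refine le_trans ?_ (show 1 ≤ 3 * 1 by norm_num)
    compute_degree
  · rw [pow_one]; rfl

theorem X_mem (d : ℝ) : (RatFunc.X : RatFunc ℝ) ∈ rrSpace d 1 := by
  refine ⟨?_, ?_⟩ <;> simp

theorem one_mem (d : ℝ) : (1 : RatFunc ℝ) ∈ rrSpace d 0 := by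
  refine ⟨?_, ?_⟩ <;> simp

theorem rrSpace_pow_mem (d : ℝ) {f : RatFunc ℝ} (hf : f ∈ rrSpace d 1) (n : ℕ) :
    f ^ n ∈ rrSpace d n := by
  induction n with
  | zero => simpa using one_mem d
  | succ n ih => rw [pow_succ]; exact rrSpace_mul_mem d ih hf

theorem pullback_mem (a d e : ℝ) {m : ℕ} (p : polyDeg m) :
    pullback a d e (p : MvPolynomial (Fin 2) ℝ) ∈ rrSpace d m := by
  have hp := (MvPolynomial.mem_restrictTotalDegree _ _ _).1 p.2
  rw [pullback, MvPolynomial.aeval_def, MvPolynomial.eval₂_eq']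
  refine Submodule.sum_mem _ (fun s hs => ?_)
  rw [← Algebra.smul_def]
  refine Submodule.smul_mem _ _ ?_
  rw [Fin.prod_univ_two]
  have hs' : s 0 + s 1 ≤ m := by
    have := (MvPolynomial.le_totalDegree hs).trans hp
    rwa [Finsupp.sum_fintype _ _ (fun _ => rfl), Fin.sum_univ_two] at this
  exact rrSpace_mono d hs' (rrSpace_mul_mem d (rrSpace_pow_mem d (h3_mem a d e) _)
    (rrSpace_pow_mem d (X_mem d) _))

/-- `L̂` on `𝓛(2k D)` extends (the transport to rational functions in `t` of) `L`. -/
def IsExtension (a d e : ℝ) {k : ℕ} (L : polyDeg (2 * k) →ₗ[ℝ] ℝ)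
    (Lhat : rrSpace d (2 * k) →ₗ[ℝ] ℝ) : Prop :=
  ∀ p : polyDeg (2 * k), Lhat ⟨pullback a d e p, pullback_mem a d e p⟩ = L p

/-- `ℝ[t]_{≤ m}`. -/
abbrev uniDeg (m : ℕ) : Submodule ℝ (Polynomial ℝ) := Polynomial.degreeLE ℝ m

theorem uniDeg_mul (k : ℕ) :
    ∀ f ∈ uniDeg (3 * k), ∀ g ∈ uniDeg (3 * k), f * g ∈ uniDeg (6 * k) := by
  intro f hf g hg
  rw [Polynomial.mem_degreeLE, ← Polynomial.natDegree_le_iff_degree_le] at *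
  exact Polynomial.natDegree_mul_le.trans (by omega)

/-- `f ↦ f / (t² - d)^(2k)` from `ℝ[t]_{≤ 6k}` to `𝓛(2k D)`. -/
def divMap (d : ℝ) (k : ℕ) : uniDeg (6 * k) →ₗ[ℝ] rrSpace d (2 * k) where
  toFun f := ⟨algebraMap _ _ (f : Polynomial ℝ) / algebraMap _ _ (h2 d ^ (2 * k)),
    (mem_rrSpace d _ _).2 ⟨f, by
      have := Polynomial.natDegree_le_iff_degree_le.2 (Polynomial.mem_degreeLE.1 f.2)
      omega, rfl⟩⟩
  map_add' f g := by
    ext; simp [add_div]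
  map_smul' c f := by
    ext
    simp only [Submodule.coe_smul, RingHom.id_apply]
    rw [← smul_div_assoc]
    congr 1
    rw [Polynomial.smul_eq_C_mul, map_mul]
    simp [RatFunc.algebraMap_C, Algebra.smul_def]

/-- The induced functional on `ℝ[t]_{≤ 6k}`, `f ↦ L̂ (f / (t² - d)^(2k))`. -/
def uniFunctional (d : ℝ) {k : ℕ} (Lhat : rrSpace d (2 * k) →ₗ[ℝ] ℝ) :
    uniDeg (6 * k) →ₗ[ℝ] ℝ :=
  Lhat ∘ₗ divMap d k

/-- The form `(f, g) ↦ ℓ (f g)` on `ℝ[t]_{≤ 3k}`. -/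
def uniForm {k : ℕ} (l : uniDeg (6 * k) →ₗ[ℝ] ℝ) : LinearMap.BilinForm ℝ (uniDeg (3 * k)) :=
  mulForm (uniDeg (3 * k)) (uniDeg (6 * k)) (uniDeg_mul k) l

/-- `p` is a generating polynomial of `ℓ`: a nonzero polynomial of lowest degree in the kernel of
the form `(f, g) ↦ ℓ (f g)` on `ℝ[t]_{≤ 3k}`. -/
def IsGenerating {k : ℕ} (l : uniDeg (6 * k) →ₗ[ℝ] ℝ) (p : uniDeg (3 * k)) : Prop :=
  p ∈ LinearMap.ker (uniForm l) ∧ p ≠ 0 ∧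
    ∀ q ∈ LinearMap.ker (uniForm l), q ≠ 0 →
      (p : Polynomial ℝ).natDegree ≤ (q : Polynomial ℝ).natDegree

/-- The generating polynomial of `ℓ` (unique up to a scalar) exists and does not vanish at
`√d` and `-√d`. -/
def GeneratingNonvanishing (d : ℝ) {k : ℕ} (l : uniDeg (6 * k) →ₗ[ℝ] ℝ) : Prop :=
  ∃ p : uniDeg (3 * k), IsGenerating l p ∧
    (p : Polynomial ℝ).eval (Real.sqrt d) ≠ 0 ∧ (p : Polynomial ℝ).eval (-Real.sqrt d) ≠ 0

/-- One of the two rank equalities holds: deleting `y^k` from the basis of `ℝ[C]_{≤ k}`, or from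
the basis of `V^(k)`, does not change the rank of the corresponding form. -/
def RankCondition (a d e : ℝ) {k : ℕ} (hk : 1 ≤ k) (L : polyDeg (2 * k) →ₗ[ℝ] ℝ)
    (hL : VanishesOnIdeal (curve a d e) L) : Prop :=
  formRank (coordForm (curve a d e) L hL) =
      formRank ((coordForm (curve a d e) L hL).restrict
        ((Submodule.span ℝ (basisB a d e k \ {cy a d e ^ k})).submoduleOf
          (coordDeg (curve a d e) k))) ∨
    formRank (localForm a d e hk L hL) =
      formRank ((localForm a d e hk L hL).restrict
        ((Submodule.span ℝ (basisBt a d e k \ {cy a d e ^ k})).submoduleOf (spaceV a d e k)))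

end CubicTMP

end

/-! Write `d = δ²`, `N = e - a t`. The curve is parametrized by `t ↦ (N / (t² - d), t)`, `t ≠ ±δ`,
and irreducibility says that `u = N(δ)ᵏ`, `v = N(-δ)ᵏ` do not vanish. Multiplication by `(t² - d)ᵏ`
identifies `ℝ[C]_{≤k}` and `V⁽ᵏ⁾` with the polynomials `q` of degree at most `3k` for which
`(q(δ), q(-δ))` is proportional to `(u, v)`, respectively to `(u, -v)`. Hence `L` is a functional on
those `Q` of degree at most `6k` with `v² Q(δ) = u² Q(-δ)`, and its extensions to all polynomials of
degree at most `6k` differ by multiples of `Q ↦ v² Q(δ) - u² Q(-δ)`. Positivity on both node spaces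
leaves room to choose the multiple so that the extension is square positive.

The rank condition provides a kernel element of full degree `3k`. It makes the Gaussian quadrature
at the roots of the generating polynomial exact, with no mass at infinity, and these nodes give
points of `C` unless they are `±δ`. Conversely, a measure representing a singular functional is
supported on the zeros of some `q ≠ 0`, so it is finitely atomic; every square positive extension is
then the same atomic functional, with generating polynomial the nodal polynomial of the atoms. -/

noncomputable section

namespace CubicTMP

open Polynomial MeasureTheory

/-! ### Positive functionals and their kernels -/

section PositiveForms

variable {V : Type*} [AddCommGroup V] [Module ℝ V] {B : LinearMap.BilinForm ℝ V}

theorem IsPos.mem_ker (hpos : IsPos B) (hB : LinearMap.IsSymm B) {x : V} (hx : B x x = 0) :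
    x ∈ LinearMap.ker B := by
  refine LinearMap.mem_ker.2 (LinearMap.ext fun y => ?_)
  have h := B.apply_sq_le_of_symm hpos hB x y
  rw [hx, zero_mul] at h
  exact pow_eq_zero_iff two_ne_zero |>.1 (le_antisymm h (sq_nonneg _))

theorem IsPos.ker_restrict (hpos : IsPos B) (hB : LinearMap.IsSymm B) (U : Submodule ℝ V) :
    LinearMap.ker (B.restrict U) = (LinearMap.ker B).comap U.subtype := by
  ext x
  refine ⟨fun hx => hpos.mem_ker hB (LinearMap.congr_fun (LinearMap.mem_ker.1 hx) x), fun hx => ?_⟩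
  refine LinearMap.mem_ker.2 (LinearMap.ext fun y => ?_)
  exact LinearMap.congr_fun (LinearMap.mem_ker.1 (show (x : V) ∈ LinearMap.ker B from hx)) y

theorem formRank_eq_restrict_iff_sup_eq_top [FiniteDimensional ℝ V] (hpos : IsPos B)
    (hB : LinearMap.IsSymm B) (U : Submodule ℝ V) :
    formRank B = formRank (B.restrict U) ↔ U ⊔ LinearMap.ker B = ⊤ := by
  have hrank := LinearMap.finrank_range_add_finrank_ker B
  have hrankU := LinearMap.finrank_range_add_finrank_ker (B.restrict U)
  have hker : Module.finrank ℝ (LinearMap.ker (B.restrict U)) =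
      Module.finrank ℝ (U ⊓ LinearMap.ker B : Submodule ℝ V) := by
    rw [hpos.ker_restrict hB, ← Submodule.finrank_map_subtype_eq U, Submodule.map_comap_subtype]
  have hsup := Submodule.finrank_sup_add_finrank_inf_eq U (LinearMap.ker B)
  have htop : U ⊔ LinearMap.ker B = ⊤ ↔
      Module.finrank ℝ (U ⊔ LinearMap.ker B : Submodule ℝ V) = Module.finrank ℝ V :=
    ⟨fun h => by rw [h, finrank_top], Submodule.eq_top_of_finrank_eq⟩
  rw [htop]
  unfold formRank
  omega

theorem formRank_eq_restrict_ker_iff [FiniteDimensional ℝ V] (hpos : IsPos B)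
    (hB : LinearMap.IsSymm B) {φ : V →ₗ[ℝ] ℝ} (hφ : φ ≠ 0) :
    formRank B = formRank (B.restrict (LinearMap.ker φ)) ↔ ∃ x ∈ LinearMap.ker B, φ x ≠ 0 := by
  have hmax : IsCoatom (LinearMap.ker φ) :=
    LinearMap.isCoatom_ker_of_surjective (LinearMap.surjective hφ)
  rw [formRank_eq_restrict_iff_sup_eq_top hpos hB, ← codisjoint_iff, ← hmax.not_le_iff_codisjoint,
    SetLike.not_le_iff_exists]
  rfl

end PositiveForms

section SquarePositive

variable {A : Type*} [CommRing A] [Algebra ℝ A]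

/-- The functional `l` is nonnegative on the squares of the elements of `W`. -/
def IsSquarePositive (l : A →ₗ[ℝ] ℝ) (W : Submodule ℝ A) : Prop :=
  ∀ q ∈ W, 0 ≤ l (q * q)

/-- The element `p` of `W` lies in the kernel of the form `(f, g) ↦ l (f * g)` on `W`. -/
def InKernel (l : A →ₗ[ℝ] ℝ) (W : Submodule ℝ A) (p : A) : Prop :=
  p ∈ W ∧ ∀ r ∈ W, l (p * r) = 0

variable {l : A →ₗ[ℝ] ℝ} {V W : Submodule ℝ A}

theorem IsSquarePositive.inKernel (hpos : IsSquarePositive l W) {q : A} (hq : q ∈ W)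
    (h : l (q * q) = 0) : InKernel l W q := by
  refine ⟨hq, fun r hr => ?_⟩
  have hB : IsPos (((LinearMap.mul ℝ A).compr₂ l).domRestrict₁₂ W W) := fun v => hpos v v.2
  have hsymm : LinearMap.IsSymm (((LinearMap.mul ℝ A).compr₂ l).domRestrict₁₂ W W) :=
    ⟨fun x y => congrArg l (mul_comm (x : A) y)⟩
  exact LinearMap.congr_fun (hB.mem_ker hsymm (x := ⟨q, hq⟩) h) ⟨r, hr⟩

theorem map_add_mul_self_of_map_mul_eq_zero {f g : A} (h : l (f * g) = 0) :
    l ((f + g) * (f + g)) = l (f * f) + l (g * g) := by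
  rw [show (f + g) * (f + g) = f * f + f * g + (f * g + g * g) by ring]
  simp only [map_add, h, zero_add, add_zero]

theorem IsSquarePositive.exists_orthogonal_projection [FiniteDimensional ℝ W] (hWV : W ≤ V)
    (hpos : IsSquarePositive l V) {g : A} (hg : g ∈ V) :
    ∃ w ∈ W, ∀ w' ∈ W, l ((g - w) * w') = 0 := by
  let T : W →ₗ[ℝ] Module.Dual ℝ W := ((LinearMap.mul ℝ A).compr₂ l).domRestrict₁₂ W W
  let F : Module.Dual ℝ W := ((LinearMap.mul ℝ A).compr₂ l g).domRestrict W
  have hF : F ∈ LinearMap.range T.dualMap := by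
    rw [LinearMap.range_dualMap_eq_dualAnnihilator_ker, Submodule.mem_dualAnnihilator]
    intro w hw
    have hww : l ((w : A) * w) = 0 := LinearMap.congr_fun (LinearMap.mem_ker.1 hw) w
    change l (g * w) = 0
    rw [mul_comm]
    exact (hpos.inKernel (hWV w.2) hww).2 g hg
  obtain ⟨ξ, hξ⟩ := hF
  obtain ⟨w, rfl⟩ := (Module.evalEquiv ℝ W).surjective ξ
  refine ⟨w, w.2, fun w' hw' => ?_⟩
  have hw : l (w' * w) = l (g * w') := LinearMap.congr_fun hξ ⟨w', hw'⟩
  rw [sub_mul, map_sub, ← hw, mul_comm w', sub_self]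

end SquarePositive

theorem mem_uniDeg {n : ℕ} {q : ℝ[X]} : q ∈ uniDeg n ↔ q.natDegree ≤ n := by
  rw [mem_degreeLE, natDegree_le_iff_degree_le]

theorem uniDeg_mono {m n : ℕ} (h : m ≤ n) : uniDeg m ≤ uniDeg n :=
  degreeLE_mono (mod_cast h)

instance finiteDimensional_uniDeg (n : ℕ) : FiniteDimensional ℝ (uniDeg n) := by
  rw [uniDeg, degreeLE_eq_span_X_pow]
  infer_instance

theorem mul_mem_uniDeg {m n : ℕ} {p q : ℝ[X]} (hp : p ∈ uniDeg m) (hq : q ∈ uniDeg n) :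
    p * q ∈ uniDeg (m + n) := by
  rw [mem_uniDeg] at *
  exact natDegree_mul_le.trans (add_le_add hp hq)

theorem mul_mem_uniDeg_two_mul {n : ℕ} {p q : ℝ[X]} (hp : p ∈ uniDeg n) (hq : q ∈ uniDeg n) :
    p * q ∈ uniDeg (2 * n) := two_mul n ▸ mul_mem_uniDeg hp hq

/-! ### Gaussian quadrature -/

/-- `p` is a nonzero polynomial of lowest degree in the kernel of `l` on `ℝ[t]_{≤ n}`. -/
def IsMinimalKernel (l : ℝ[X] →ₗ[ℝ] ℝ) (n : ℕ) (p : ℝ[X]) : Prop :=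
  InKernel l (uniDeg n) p ∧ p ≠ 0 ∧
    ∀ q, InKernel l (uniDeg n) q → q ≠ 0 → p.natDegree ≤ q.natDegree

/-- The finitely atomic functional `Q ↦ ∑ w(t) Q(t)`, the sum over `t ∈ S`. -/
def atomic (S : Finset ℝ) (w : ℝ → ℝ) : ℝ[X] →ₗ[ℝ] ℝ := ∑ t ∈ S, w t • leval t

theorem atomic_apply (S : Finset ℝ) (w : ℝ → ℝ) (Q : ℝ[X]) :
    atomic S w Q = ∑ t ∈ S, w t * Q.eval t := by
  simp [atomic, leval]

theorem atomic_mul_eq_zero {S : Finset ℝ} {w : ℝ → ℝ} {q : ℝ[X]}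
    (hq : ∀ t ∈ S, w t * q.eval t = 0) (r : ℝ[X]) : atomic S w (q * r) = 0 := by
  rw [atomic_apply]
  exact Finset.sum_eq_zero fun t ht => by rw [eval_mul, ← mul_assoc, hq t ht, zero_mul]

section Quadrature

variable {l : ℝ[X] →ₗ[ℝ] ℝ} {n : ℕ} {p q : ℝ[X]}

theorem InKernel.X_pow_mul (hpos : IsSquarePositive l (uniDeg n)) (hp : InKernel l (uniDeg n) p)
    (i : ℕ) (hi : p.natDegree + i + 1 ≤ n) : InKernel l (uniDeg n) (X ^ i * p) := by
  induction i with
  | zero => simpa using hp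
  | succ i ih =>
    have hdeg (j : ℕ) : (X ^ j * p).natDegree ≤ j + p.natDegree := natDegree_mul_le.trans (by simp)
    refine hpos.inKernel (mem_uniDeg.2 ((hdeg _).trans (by omega))) ?_
    rw [show X ^ (i + 1) * p * (X ^ (i + 1) * p) = X ^ i * p * (X ^ (i + 2) * p) by ring]
    exact (ih (by omega)).2 _ (mem_uniDeg.2 ((hdeg _).trans (by omega)))

theorem InKernel.apply_mul (hpos : IsSquarePositive l (uniDeg n)) (hp : InKernel l (uniDeg n) p)
    {g : ℝ[X]} (hg : p.natDegree + g.natDegree + 1 ≤ 2 * n) : l (p * g) = 0 := by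
  rw [g.as_sum_range_C_mul_X_pow, Finset.mul_sum, map_sum]
  refine Finset.sum_eq_zero fun i hi => ?_
  rw [Finset.mem_range] at hi
  rw [mul_left_comm, ← smul_eq_C_mul, map_smul]
  rcases le_or_gt i n with h | h
  · rw [hp.2 _ (mem_uniDeg.2 (by simpa using h)), smul_zero]
  · rw [show p * X ^ i = X ^ (i - n) * p * X ^ n by
      rw [mul_right_comm, ← pow_add, Nat.sub_add_cancel h.le, mul_comm],
      (hp.X_pow_mul hpos (i - n) (by omega)).2 _ (mem_uniDeg.2 (by simp)), smul_zero]

theorem IsMinimalKernel.not_dvd (hpos : IsSquarePositive l (uniDeg n))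
    (hp : IsMinimalKernel l n p) (b : ℝ) {c : ℝ} (hc : 0 ≤ c) :
    ¬ (X - C b) ^ 2 + C c ∣ p := by
  rintro ⟨r, rfl⟩
  have hq : ((X - C b) ^ 2 + C c : ℝ[X]).natDegree = 2 := by
    rw [natDegree_add_C, natDegree_pow, natDegree_X_sub_C]
  obtain ⟨hq0, hr0⟩ := mul_ne_zero_iff.1 hp.2.1
  have hs0 : (X - C b) * r ≠ 0 := mul_ne_zero (X_sub_C_ne_zero b) hr0
  have hdeg := natDegree_mul hq0 hr0
  have hsdeg : ((X - C b) * r).natDegree = 1 + r.natDegree := by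
    rw [natDegree_mul (X_sub_C_ne_zero b) hr0, natDegree_X_sub_C]
  have hpn := mem_uniDeg.1 hp.1.1
  have hr : r ∈ uniDeg n := mem_uniDeg.2 (by omega)
  have hs : (X - C b) * r ∈ uniDeg n := mem_uniDeg.2 (by omega)
  have hsum : l ((X - C b) * r * ((X - C b) * r)) + c * l (r * r) = 0 := by
    rw [← smul_eq_mul c, ← map_smul, ← map_add, ← hp.1.2 r hr, smul_eq_C_mul]
    ring_nf
  have hzero : l ((X - C b) * r * ((X - C b) * r)) = 0 := by
    linarith [hpos _ hs, mul_nonneg hc (hpos r hr)]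
  have hmin := hp.2.2 _ (hpos.inKernel hs hzero) hs0
  omega

theorem nodal_roots_dvd (p : ℝ[X]) : Lagrange.nodal p.roots.toFinset id ∣ p := by
  refine dvd_trans ?_ p.prod_multiset_X_sub_C_dvd
  rw [Lagrange.nodal_eq]
  exact Multiset.prod_dvd_prod_of_le (Multiset.map_le_map (Multiset.dedup_le _))

theorem sq_add_sq_dvd_of_aeval_eq_zero {h : ℝ[X]} {z : ℂ} (hz : aeval z h = 0)
    (him : z.im ≠ 0) : (X - C z.re) ^ 2 + C (z.im ^ 2) ∣ h := by
  convert quadratic_dvd_of_aeval_eq_zero_im_ne_zero h hz him using 1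
  rw [Complex.sq_norm, Complex.normSq_apply]
  simp only [map_add, map_mul, map_pow, map_ofNat]
  ring

theorem IsMinimalKernel.exists_eq_C_mul_nodal (hpos : IsSquarePositive l (uniDeg n))
    (hp : IsMinimalKernel l n p) :
    ∃ c : ℝ, c ≠ 0 ∧ p = C c * Lagrange.nodal p.roots.toFinset id := by
  obtain ⟨h, hh⟩ := nodal_roots_dvd p
  have hh0 : h ≠ 0 := by rintro rfl; exact hp.2.1 (by simpa using hh)
  by_contra! hconst
  have hdeg : h.degree ≠ 0 := fun hd => by
    rw [eq_C_of_degree_eq_zero hd, mul_comm] at hh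
    exact hconst _ (coeff_ne_zero_of_eq_degree hd) hh
  obtain ⟨z, hz⟩ := IsAlgClosed.exists_aeval_eq_zero ℂ h hdeg
  have hhp : h ∣ p := Dvd.intro_left _ hh.symm
  refine hp.not_dvd hpos z.re (sq_nonneg z.im) ?_
  by_cases him : z.im = 0
  · obtain ⟨x, rfl⟩ : ∃ x : ℝ, (x : ℂ) = z := ⟨z.re, Complex.ext rfl him.symm⟩
    have hroot : h.IsRoot x := by
      rwa [← Complex.coe_algebraMap, aeval_algebraMap_apply,
        map_eq_zero_iff _ (algebraMap ℝ ℂ).injective, coe_aeval_eq_eval] at hz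
    have hx : x ∈ p.roots.toFinset := by
      rw [Multiset.mem_toFinset, mem_roots hp.2.1]
      exact hroot.dvd hhp
    simp only [Complex.ofReal_re, Complex.ofReal_im, ne_eq, OfNat.ofNat_ne_zero,
      not_false_eq_true, zero_pow, map_zero, add_zero]
    rw [hh, sq]
    exact mul_dvd_mul (Lagrange.X_sub_C_dvd_nodal (v := id) hx) (dvd_iff_isRoot.2 hroot)
  · exact (sq_add_sq_dvd_of_aeval_eq_zero hz him).trans hhp

theorem eval_nodal_id_eq_zero {S : Finset ℝ} {t : ℝ} (ht : t ∈ S) :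
    (Lagrange.nodal S id).eval t = 0 :=
  Lagrange.eval_nodal_at_node (v := id) ht

theorem modByMonic_nodal (S : Finset ℝ) (f : ℝ[X]) :
    f %ₘ Lagrange.nodal S id = ∑ t ∈ S, f.eval t • Lagrange.basis S id t := by
  have hm : (Lagrange.nodal S (id : ℝ → ℝ)).Monic := Lagrange.nodal_monic
  rw [Lagrange.eq_interpolate_of_eval_eq (s := S) (v := id) (fun t => f.eval t)
    (f := f %ₘ Lagrange.nodal S id) Function.injective_id.injOn, Lagrange.interpolate_apply]
  · simp only [smul_eq_C_mul]
  · rw [← Lagrange.degree_nodal (s := S) (v := (id : ℝ → ℝ))]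
    exact degree_modByMonic_lt _ hm
  · intro t ht
    rw [id, modByMonic_eq_sub_mul_div, eval_sub, eval_mul, eval_nodal_id_eq_zero ht, zero_mul,
      sub_zero]

theorem eval_basis_id {S : Finset ℝ} {s t : ℝ} (hs : s ∈ S) (ht : t ∈ S) :
    (Lagrange.basis S id t).eval s = if s = t then 1 else 0 := by
  split_ifs with h
  · subst h
    exact Lagrange.eval_basis_self (v := id) Function.injective_id.injOn ht
  · exact Lagrange.eval_basis_of_ne (v := id) (Ne.symm h) hs

theorem IsMinimalKernel.eq_atomic_of_degree_lt (hpos : IsSquarePositive l (uniDeg n))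
    (hp : IsMinimalKernel l n p) {f : ℝ[X]} (hf : f.degree < (2 * n : ℕ)) :
    l f = atomic p.roots.toFinset (fun t => l (Lagrange.basis p.roots.toFinset id t)) f := by
  set N := Lagrange.nodal p.roots.toFinset (id : ℝ → ℝ)
  obtain ⟨c, hc, hpN⟩ := hp.exists_eq_C_mul_nodal hpos
  have hN : N.Monic := Lagrange.nodal_monic
  have hdiv : l (N * (f /ₘ N)) = 0 := by
    rcases eq_or_ne (f /ₘ N) 0 with h0 | h0
    · rw [h0, mul_zero, map_zero]
    have hNf : N.natDegree ≤ f.natDegree := by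
      by_contra! h
      exact h0 ((divByMonic_eq_zero_iff hN).2 (degree_lt_degree h))
    have hf' := natDegree_lt_iff_degree_lt (by rintro rfl; simp at h0) |>.2 hf
    have hpdeg : p.natDegree = N.natDegree := by rw [hpN, natDegree_C_mul hc]
    have h := hp.1.apply_mul hpos (g := f /ₘ N) (by rw [natDegree_divByMonic f hN]; omega)
    rw [hpN, mul_assoc, ← smul_eq_C_mul, map_smul, smul_eq_mul] at h
    exact (mul_eq_zero.1 h).resolve_left hc
  conv_lhs => rw [← modByMonic_add_div f N, map_add, hdiv, add_zero, modByMonic_nodal, map_sum]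
  rw [atomic_apply]
  exact Finset.sum_congr rfl fun t _ => by rw [map_smul, smul_eq_mul, mul_comm]

theorem IsMinimalKernel.natDegree_basis_lt (hp : IsMinimalKernel l n p) {t : ℝ}
    (ht : t ∈ p.roots.toFinset) : (Lagrange.basis p.roots.toFinset id t).natDegree < n := by
  rw [Lagrange.natDegree_basis Function.injective_id.injOn ht]
  have hcard := (Multiset.toFinset_card_le _).trans p.card_roots'
  have hpn := mem_uniDeg.1 hp.1.1
  have hpos := Finset.card_pos.2 ⟨t, ht⟩
  omega

theorem IsMinimalKernel.apply_mul_basis (hpos : IsSquarePositive l (uniDeg n))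
    (hp : IsMinimalKernel l n p) (hq : q ∈ uniDeg n) {t : ℝ} (ht : t ∈ p.roots.toFinset) :
    l (q * Lagrange.basis p.roots.toFinset id t) =
      l (Lagrange.basis p.roots.toFinset id t) * q.eval t := by
  have hdeg : (q * Lagrange.basis p.roots.toFinset id t).natDegree < 2 * n := by
    have h := hp.natDegree_basis_lt ht
    have := mem_uniDeg.1 hq
    exact natDegree_mul_le.trans_lt (by omega)
  rw [hp.eq_atomic_of_degree_lt hpos (degree_le_natDegree.trans_lt (by exact_mod_cast hdeg)),
    atomic_apply, Finset.sum_eq_single_of_mem t ht]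
  · rw [eval_mul, eval_basis_id ht ht, if_pos rfl, mul_one]
  · intro s hs hst
    rw [eval_mul, eval_basis_id hs ht, if_neg hst, mul_zero, mul_zero]

theorem IsMinimalKernel.exists_quadrature (hpos : IsSquarePositive l (uniDeg n))
    (hp : IsMinimalKernel l n p) (hq : InKernel l (uniDeg n) q) (hqn : q.coeff n ≠ 0) :
    ∃ w : ℝ → ℝ, (∀ t ∈ p.roots.toFinset, 0 ≤ w t) ∧
      ∀ Q ∈ uniDeg (2 * n), l Q = atomic p.roots.toFinset w Q := by
  have hbasis : ∀ t ∈ p.roots.toFinset, Lagrange.basis p.roots.toFinset id t ∈ uniDeg n :=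
    fun t ht => mem_uniDeg.2 (hp.natDegree_basis_lt ht).le
  refine ⟨fun t => l (Lagrange.basis p.roots.toFinset id t), fun t ht => ?_, fun Q hQ => ?_⟩
  · have h := hpos _ (hbasis t ht)
    rwa [hp.apply_mul_basis hpos (hbasis t ht) ht, eval_basis_id ht ht, if_pos rfl, mul_one] at h
  have hqX : atomic p.roots.toFinset (fun t => l (Lagrange.basis p.roots.toFinset id t))
      (q * X ^ n) = l (q * X ^ n) := by
    rw [hq.2 _ (mem_uniDeg.2 (natDegree_X_pow n).le)]
    refine atomic_mul_eq_zero (fun t ht => ?_) _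
    rw [← hp.apply_mul_basis hpos hq.1 ht, hq.2 _ (hbasis t ht)]
  set c := Q.coeff (2 * n) / q.coeff n
  have hred : degree (Q - c • (q * X ^ n)) < (2 * n : ℕ) := by
    have hle : Q - c • (q * X ^ n) ∈ uniDeg (2 * n) := Submodule.sub_mem _ hQ
      (Submodule.smul_mem _ _ (mul_mem_uniDeg_two_mul hq.1 (mem_uniDeg.2 (natDegree_X_pow n).le)))
    refine lt_of_le_of_ne (mem_degreeLE.1 hle) fun hdeg => coeff_ne_zero_of_eq_degree hdeg ?_
    rw [coeff_sub, coeff_smul, two_mul, coeff_mul_X_pow, ← two_mul, smul_eq_mul,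
      div_mul_cancel₀ _ hqn, sub_self]
  have h := hp.eq_atomic_of_degree_lt hpos hred
  simp only [map_sub, map_smul, hqX] at h
  exact sub_left_injective h

end Quadrature

/-! ### Polynomials with a prescribed ratio of values at `δ` and `-δ` -/

/-- The polynomial of degree at most one with value `x` at `δ` and `y` at `-δ`. -/
def lineThrough (δ x y : ℝ) : ℝ[X] := C ((x + y) / 2) + C ((x - y) / (2 * δ)) * X

theorem eval_lineThrough {δ : ℝ} (hδ : δ ≠ 0) (x y : ℝ) : (lineThrough δ x y).eval δ = x := by
  simp only [lineThrough, eval_add, eval_mul, eval_C, eval_X]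
  field_simp
  ring

theorem eval_neg_lineThrough {δ : ℝ} (hδ : δ ≠ 0) (x y : ℝ) :
    (lineThrough δ x y).eval (-δ) = y := by
  simp only [lineThrough, eval_add, eval_mul, eval_C, eval_X]
  field_simp
  ring

theorem lineThrough_mem_uniDeg (δ x y : ℝ) : lineThrough δ x y ∈ uniDeg 1 := by
  rw [mem_uniDeg, lineThrough]
  compute_degree

/-- The functional `q ↦ v q(δ) - u q(-δ)`, which vanishes when `(q(δ), q(-δ))` is proportional to
`(u, v) ≠ 0`. -/
def nodeFunctional (δ u v : ℝ) : ℝ[X] →ₗ[ℝ] ℝ := v • leval δ - u • leval (-δ)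

theorem nodeFunctional_apply (δ u v : ℝ) (q : ℝ[X]) :
    nodeFunctional δ u v q = v * q.eval δ - u * q.eval (-δ) := by
  simp [nodeFunctional, leval]

/-- The polynomials of degree at most `n` with `(q(δ), q(-δ))` proportional to `(u, v) ≠ 0`. -/
def nodeSpace (δ u v : ℝ) (n : ℕ) : Submodule ℝ ℝ[X] :=
  uniDeg n ⊓ LinearMap.ker (nodeFunctional δ u v)

section NodeSpace

variable {δ u v : ℝ} {m n : ℕ} {p q : ℝ[X]} {l l' : ℝ[X] →ₗ[ℝ] ℝ}

theorem mem_nodeSpace :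
    q ∈ nodeSpace δ u v n ↔ q ∈ uniDeg n ∧ v * q.eval δ = u * q.eval (-δ) := by
  rw [nodeSpace, Submodule.mem_inf, LinearMap.mem_ker, nodeFunctional_apply, sub_eq_zero]

theorem mul_mem_nodeSpace {u' v' : ℝ} (hp : p ∈ nodeSpace δ u v m)
    (hq : q ∈ nodeSpace δ u' v' n) : p * q ∈ nodeSpace δ (u * u') (v * v') (m + n) := by
  rw [mem_nodeSpace] at *
  refine ⟨mul_mem_uniDeg hp.1 hq.1, ?_⟩
  rw [eval_mul, eval_mul, mul_mul_mul_comm, hp.2, hq.2, mul_mul_mul_comm]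

theorem mul_mem_nodeSpace_sq (hp : p ∈ nodeSpace δ u v n) (hq : q ∈ nodeSpace δ u v n) :
    p * q ∈ nodeSpace δ (u ^ 2) (v ^ 2) (2 * n) := by
  rw [pow_two, pow_two, two_mul]
  exact mul_mem_nodeSpace hp hq

theorem mul_mem_nodeSpace_sq_of_neg (hp : p ∈ nodeSpace δ u (-v) n)
    (hq : q ∈ nodeSpace δ u (-v) n) : p * q ∈ nodeSpace δ (u ^ 2) (v ^ 2) (2 * n) := by
  rw [← neg_sq v]
  exact mul_mem_nodeSpace_sq hp hq

theorem exists_eq_add_mul_nodeFunctional (h : ∀ Q ∈ nodeSpace δ u v n, l Q = l' Q) :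
    ∃ s : ℝ, ∀ Q ∈ uniDeg n, l Q = l' Q + s * nodeFunctional δ u v Q := by
  have hker : ⨅ _ : Unit, LinearMap.ker ((nodeFunctional δ u v).domRestrict (uniDeg n)) ≤
      LinearMap.ker ((l - l').domRestrict (uniDeg n)) := by
    rw [ciInf_const]
    exact fun Q hQ => sub_eq_zero.2 (h Q ⟨Q.2, hQ⟩)
  have hspan := mem_span_of_iInf_ker_le_ker hker
  rw [Set.range_const, Submodule.mem_span_singleton] at hspan
  obtain ⟨s, hs⟩ := hspan
  exact ⟨s, fun Q hQ => eq_add_of_sub_eq' (LinearMap.congr_fun hs ⟨Q, hQ⟩).symm⟩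

/-! ### Extending a positive functional from two node spaces -/

theorem exists_orthogonal_interpolant (hδ : δ ≠ 0) (hn : 1 ≤ n)
    (hpos : IsSquarePositive l (nodeSpace δ u v n)) :
    ∃ p ∈ nodeSpace δ u v n, p.eval δ = u ∧ p.eval (-δ) = v ∧
      ∀ w ∈ uniDeg n, w.eval δ = 0 → w.eval (-δ) = 0 → l (p * w) = 0 := by
  let W : Submodule ℝ ℝ[X] :=
    uniDeg n ⊓ (LinearMap.ker (leval (R := ℝ) δ) ⊓ LinearMap.ker (leval (R := ℝ) (-δ)))
  have hWV : W ≤ nodeSpace δ u v n := by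
    rintro w ⟨hw, hw₁, hw₂⟩
    refine mem_nodeSpace.2 ⟨hw, ?_⟩
    rw [show w.eval δ = 0 from hw₁, show w.eval (-δ) = 0 from hw₂, mul_zero, mul_zero]
  have : FiniteDimensional ℝ W := Submodule.finiteDimensional_of_le inf_le_left
  have hline : lineThrough δ u v ∈ nodeSpace δ u v n := by
    refine mem_nodeSpace.2 ⟨uniDeg_mono hn (lineThrough_mem_uniDeg δ u v), ?_⟩
    rw [eval_lineThrough hδ, eval_neg_lineThrough hδ, mul_comm]
  obtain ⟨w, ⟨hw, hw₁, hw₂⟩, horth⟩ := hpos.exists_orthogonal_projection hWV hline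
  refine ⟨_, Submodule.sub_mem _ hline (hWV ⟨hw, hw₁, hw₂⟩), ?_, ?_,
    fun w' hw' h₁ h₂ => horth w' ⟨hw', h₁, h₂⟩⟩
  · rw [eval_sub, eval_lineThrough hδ, show w.eval δ = 0 from hw₁, sub_zero]
  · rw [eval_sub, eval_neg_lineThrough hδ, show w.eval (-δ) = 0 from hw₂, sub_zero]

theorem exists_eq_smul_add_smul_add (hu : u ≠ 0) (hv : v ≠ 0) (hp : p ∈ uniDeg n)
    (hq : q ∈ uniDeg n) (hp₁ : p.eval δ = u) (hp₂ : p.eval (-δ) = v) (hq₁ : q.eval δ = u)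
    (hq₂ : q.eval (-δ) = -v) {f : ℝ[X]} (hf : f ∈ uniDeg n) :
    ∃ x y : ℝ, ∃ w ∈ uniDeg n, w.eval δ = 0 ∧ w.eval (-δ) = 0 ∧ f = x • p + y • q + w := by
  refine ⟨(f.eval δ / u + f.eval (-δ) / v) / 2, (f.eval δ / u - f.eval (-δ) / v) / 2, _,
    Submodule.sub_mem _ hf (Submodule.add_mem _ (Submodule.smul_mem _ _ hp)
      (Submodule.smul_mem _ _ hq)), ?_, ?_, (add_sub_cancel _ f).symm⟩
  · simp only [eval_sub, eval_add, eval_smul, hp₁, hq₁, smul_eq_mul]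
    field_simp
    ring
  · simp only [eval_sub, eval_add, eval_smul, hp₂, hq₂, smul_eq_mul]
    field_simp
    ring

/-- The correction by a multiple of `nodeFunctional` makes the two orthogonal interpolants
orthogonal to each other. -/
theorem exists_isSquarePositive_uniDeg (hδ : δ ≠ 0) (hu : u ≠ 0) (hv : v ≠ 0) (hn : 1 ≤ n)
    (hpos : IsSquarePositive l (nodeSpace δ u v n))
    (hpos' : IsSquarePositive l (nodeSpace δ u (-v) n)) :
    ∃ l' : ℝ[X] →ₗ[ℝ] ℝ, (∀ Q ∈ nodeSpace δ (u ^ 2) (v ^ 2) (2 * n), l' Q = l Q) ∧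
      IsSquarePositive l' (uniDeg n) := by
  obtain ⟨p, hp, hp₁, hp₂, hpw⟩ := exists_orthogonal_interpolant hδ hn hpos
  obtain ⟨q, hq, hq₁, hq₂, hqw⟩ := exists_orthogonal_interpolant hδ hn hpos'
  have hc : nodeFunctional δ (u ^ 2) (v ^ 2) (p * q) ≠ 0 := by
    rw [nodeFunctional_apply, eval_mul, eval_mul, hp₁, hp₂, hq₁, hq₂]
    ring_nf
    positivity
  set l' := l - (l (p * q) / nodeFunctional δ (u ^ 2) (v ^ 2) (p * q)) •
    nodeFunctional δ (u ^ 2) (v ^ 2) with hl'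
  have hpq : l' (p * q) = 0 := by
    rw [hl', LinearMap.sub_apply, LinearMap.smul_apply, smul_eq_mul, div_mul_cancel₀ _ hc, sub_self]
  have heq : ∀ Q ∈ nodeSpace δ (u ^ 2) (v ^ 2) (2 * n), l' Q = l Q := fun Q hQ => by
    rw [hl', LinearMap.sub_apply, LinearMap.smul_apply, LinearMap.mem_ker.1 hQ.2, smul_zero,
      sub_zero]
  refine ⟨l', heq, fun f hf => ?_⟩
  obtain ⟨x, y, w, hw, hw₁, hw₂, rfl⟩ :=
    exists_eq_smul_add_smul_add hu hv hp.1 hq.1 hp₁ hp₂ hq₁ hq₂ hf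
  have hwA : w ∈ nodeSpace δ u v n := mem_nodeSpace.2 ⟨hw, by rw [hw₁, hw₂, mul_zero, mul_zero]⟩
  have hwB : w ∈ nodeSpace δ u (-v) n :=
    mem_nodeSpace.2 ⟨hw, by rw [hw₁, hw₂, mul_zero, mul_zero]⟩
  rw [map_add_mul_self_of_map_mul_eq_zero, map_add_mul_self_of_map_mul_eq_zero,
    heq _ (mul_mem_nodeSpace_sq hwA hwA),
    heq _ (mul_mem_nodeSpace_sq (Submodule.smul_mem _ x hp) (Submodule.smul_mem _ x hp)),
    heq _ (mul_mem_nodeSpace_sq_of_neg (Submodule.smul_mem _ y hq) (Submodule.smul_mem _ y hq))]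
  · exact add_nonneg (add_nonneg (hpos _ (Submodule.smul_mem _ x hp))
      (hpos' _ (Submodule.smul_mem _ y hq))) (hpos w hwA)
  · rw [smul_mul_smul_comm, map_smul, hpq, smul_zero]
  · rw [add_mul, smul_mul_assoc, smul_mul_assoc, map_add, map_smul, map_smul,
      heq _ (mul_mem_nodeSpace_sq hp hwA), heq _ (mul_mem_nodeSpace_sq_of_neg hq hwB),
      hpw w hw hw₁ hw₂, hqw w hw hw₁ hw₂, smul_zero, smul_zero, add_zero]

end NodeSpace

/-! ### Finitely atomic functionals -/

section Atomic

variable {S : Finset ℝ} {w : ℝ → ℝ} {δ u v : ℝ} {n : ℕ} {l : ℝ[X] →ₗ[ℝ] ℝ} {q : ℝ[X]}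

theorem eval_eq_zero_of_atomic_mul_self_eq_zero (hw : ∀ t ∈ S, 0 < w t)
    (h : atomic S w (q * q) = 0) {t : ℝ} (ht : t ∈ S) : q.eval t = 0 := by
  have hnonneg : ∀ t ∈ S, 0 ≤ w t * (q * q).eval t := fun t ht =>
    mul_nonneg (hw t ht).le (by rw [eval_mul]; exact mul_self_nonneg _)
  rw [atomic_apply, Finset.sum_eq_zero_iff_of_nonneg hnonneg] at h
  simpa [(hw t ht).ne'] using h t ht

theorem eval_nodal_id_ne_zero {t : ℝ} (ht : t ∉ S) : (Lagrange.nodal S id).eval t ≠ 0 :=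
  Lagrange.eval_nodal_not_at_node fun _ hi h => ht (h ▸ hi)

theorem card_le_natDegree (hq0 : q ≠ 0) (hq : ∀ t ∈ S, q.eval t = 0) : S.card ≤ q.natDegree :=
  (Finset.card_le_card fun t ht => Multiset.mem_toFinset.2 ((mem_roots hq0).2 (hq t ht))).trans
    ((Multiset.toFinset_card_le _).trans q.card_roots')

theorem isMinimalKernel_nodal (hw : ∀ t ∈ S, 0 < w t) (hS : S.card ≤ n)
    (hl : ∀ Q ∈ uniDeg (2 * n), l Q = atomic S w Q) :
    IsMinimalKernel l n (Lagrange.nodal S id) := by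
  have hN : Lagrange.nodal S id ∈ uniDeg n := mem_uniDeg.2 (Lagrange.natDegree_nodal.trans_le hS)
  refine ⟨⟨hN, fun r hr => ?_⟩, Lagrange.nodal_ne_zero, fun q hq hq0 => ?_⟩
  · rw [hl _ (mul_mem_uniDeg_two_mul hN hr)]
    exact atomic_mul_eq_zero (fun t ht => by rw [eval_nodal_id_eq_zero ht, mul_zero]) r
  · rw [Lagrange.natDegree_nodal]
    refine card_le_natDegree hq0 fun t ht => eval_eq_zero_of_atomic_mul_self_eq_zero hw ?_ ht
    rw [← hl _ (mul_mem_uniDeg_two_mul hq.1 hq.1)]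
    exact hq.2 q hq.1

theorem eq_zero_of_mul_nodeFunctional_nonneg (hδ : δ ≠ 0) (hu : u ≠ 0) (hv : v ≠ 0)
    (hδS : δ ∉ S) (hδS' : -δ ∉ S) (hS : S.card < n) {s : ℝ}
    (h : ∀ q ∈ uniDeg n, (∀ t ∈ S, q.eval t = 0) →
      0 ≤ s * nodeFunctional δ (u ^ 2) (v ^ 2) (q * q)) : s = 0 := by
  have key (x y : ℝ) : 0 ≤ s * nodeFunctional δ (u ^ 2) (v ^ 2)
      (Lagrange.nodal S id * lineThrough δ x y * (Lagrange.nodal S id * lineThrough δ x y)) := by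
    have hdeg : Lagrange.nodal S id * lineThrough δ x y ∈ uniDeg (S.card + 1) :=
      mul_mem_uniDeg (mem_uniDeg.2 Lagrange.natDegree_nodal.le) (lineThrough_mem_uniDeg δ x y)
    refine h _ (uniDeg_mono hS hdeg) fun t ht => ?_
    rw [eval_mul, eval_nodal_id_eq_zero ht, zero_mul]
  simp only [nodeFunctional_apply, eval_mul, eval_lineThrough hδ, eval_neg_lineThrough hδ] at key
  have hN := eval_nodal_id_ne_zero hδS
  have hN' := eval_nodal_id_ne_zero hδS'
  refine le_antisymm (le_of_mul_le_mul_right (a := u ^ 2 * ((Lagrange.nodal S id).eval (-δ)) ^ 2) ?_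
    (by positivity)) (le_of_mul_le_mul_right (a := v ^ 2 * ((Lagrange.nodal S id).eval δ) ^ 2) ?_
    (by positivity))
  · linarith [key 0 1]
  · linarith [key 1 0]

theorem eq_atomic_of_eq_on_nodeSpace (hδ : δ ≠ 0) (hu : u ≠ 0) (hv : v ≠ 0) (hn : 1 ≤ n)
    (hδS : δ ∉ S) (hδS' : -δ ∉ S) (hpos : IsSquarePositive l (uniDeg n))
    (hl : ∀ Q ∈ nodeSpace δ (u ^ 2) (v ^ 2) (2 * n), l Q = atomic S w Q) (hqn : q ∈ uniDeg n)
    (hq : q * q ∈ nodeSpace δ (u ^ 2) (v ^ 2) (2 * n)) (hq0 : q ≠ 0)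
    (hqS : ∀ t ∈ S, q.eval t = 0) : ∀ Q ∈ uniDeg (2 * n), l Q = atomic S w Q := by
  obtain ⟨s, hs⟩ := exists_eq_add_mul_nodeFunctional hl
  have hmul {q r : ℝ[X]} (hq : q ∈ uniDeg n) (hr : r ∈ uniDeg n) (hqS : ∀ t ∈ S, q.eval t = 0) :
      l (q * r) = s * nodeFunctional δ (u ^ 2) (v ^ 2) (q * r) := by
    rw [hs _ (mul_mem_uniDeg_two_mul hq hr), atomic_mul_eq_zero
      (fun t ht => by rw [hqS t ht, mul_zero]), zero_add]
  suffices hs0 : s = 0 from fun Q hQ => by rw [hs Q hQ, hs0, zero_mul, add_zero]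
  rcases lt_or_ge S.card n with hlt | hge
  · exact eq_zero_of_mul_nodeFunctional_nonneg hδ hu hv hδS hδS' hlt fun r hr hrS =>
      hmul hr hr hrS ▸ hpos r hr
  · have hroot : q.eval (-δ) ≠ 0 := fun h0 => by
      have h := card_le_natDegree (S := insert (-δ) S) hq0
        (Finset.forall_mem_insert _ _ _ |>.2 ⟨h0, hqS⟩)
      rw [Finset.card_insert_of_notMem hδS'] at h
      have := mem_uniDeg.1 hqn
      omega
    have hq2 : l (q * q) = 0 := by
      rw [hmul hqn hqn hqS, LinearMap.mem_ker.1 hq.2, mul_zero]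
    have hline : lineThrough δ 0 1 ∈ uniDeg n := uniDeg_mono hn (lineThrough_mem_uniDeg δ 0 1)
    have h := (hpos.inKernel hqn hq2).2 _ hline
    rw [hmul hqn hline hqS, nodeFunctional_apply, eval_mul, eval_mul, eval_lineThrough hδ,
      eval_neg_lineThrough hδ] at h
    simpa [hu, hroot] using h

theorem exists_monic_mul_mem_nodeSpace (hδ : δ ≠ 0) (hv : v ≠ 0) {M : ℝ[X]} (hM : M.Monic)
    (hMδ : M.eval δ ≠ 0) : ∃ c : ℝ,
      M * (X - C c) ∈ nodeSpace δ u v (M.natDegree + 1) ∨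
        M * (X - C c) ∈ nodeSpace δ u (-v) (M.natDegree + 1) := by
  have hdeg (c : ℝ) : M * (X - C c) ∈ uniDeg (M.natDegree + 1) := by
    rw [mem_uniDeg, hM.natDegree_mul (monic_X_sub_C c), natDegree_X_sub_C]
  simp only [mem_nodeSpace, hdeg, true_and, eval_mul, eval_sub, eval_X, eval_C, ← mul_assoc]
  have : v * M.eval δ ≠ 0 := mul_ne_zero hv hMδ
  rcases eq_or_ne (v * M.eval δ) (u * M.eval (-δ)) with h | h
  · exact ⟨0, Or.inr (by rw [neg_mul, h]; ring)⟩
  · refine ⟨δ * (v * M.eval δ + u * M.eval (-δ)) / (v * M.eval δ - u * M.eval (-δ)), Or.inl ?_⟩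
    have := sub_ne_zero.2 h
    field_simp
    ring

theorem exists_coeff_ne_zero_of_vanishing (hδ : δ ≠ 0) (hv : v ≠ 0) (hδS : δ ∉ S)
    (hq : q ∈ nodeSpace δ u v n ∨ q ∈ nodeSpace δ u (-v) n) (hq0 : q ≠ 0)
    (hqS : ∀ t ∈ S, q.eval t = 0) :
    ∃ r, (r ∈ nodeSpace δ u v n ∨ r ∈ nodeSpace δ u (-v) n) ∧ r.coeff n ≠ 0 ∧
      ∀ t ∈ S, r.eval t = 0 := by
  have hqn : q.natDegree ≤ n := mem_uniDeg.1 (hq.elim (·.1) (·.1))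
  have hcard := card_le_natDegree hq0 hqS
  rcases (hcard.trans hqn).eq_or_lt with hS | hS
  · refine ⟨q, hq, ?_, hqS⟩
    rw [show n = q.natDegree by omega]
    exact leadingCoeff_ne_zero.2 hq0
  set M := Lagrange.nodal S id * X ^ (n - 1 - S.card) with hM
  have hMmonic : M.Monic := Lagrange.nodal_monic.mul (monic_X_pow _)
  have hMdeg : M.natDegree + 1 = n := by
    rw [Lagrange.nodal_monic.natDegree_mul (monic_X_pow _), Lagrange.natDegree_nodal,
      natDegree_X_pow]
    omega
  have hMδ : M.eval δ ≠ 0 := by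
    simp [hM, hδ, eval_nodal_id_ne_zero hδS]
  obtain ⟨c, hc⟩ := exists_monic_mul_mem_nodeSpace (u := u) hδ hv hMmonic hMδ
  rw [hMdeg] at hc
  refine ⟨_, hc, ?_, fun t ht => ?_⟩
  · have hr := hMmonic.mul (monic_X_sub_C c)
    rw [← hMdeg, ← natDegree_X_sub_C c, ← hMmonic.natDegree_mul (monic_X_sub_C c),
      coeff_natDegree, hr.leadingCoeff]
    exact one_ne_zero
  · rw [eval_mul, hM, eval_mul, eval_nodal_id_eq_zero ht, zero_mul, zero_mul]

end Atomic

/-! ### The parametrization of the curve -/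

/-- The numerator `-a t + e` of the first coordinate of the parametrization. -/
def num (a e : ℝ) : ℝ[X] := -(C a * X) + C e

theorem num_mem_uniDeg (a e : ℝ) : num a e ∈ uniDeg 1 := by
  rw [mem_uniDeg, num]
  compute_degree

theorem eval_num (a e t : ℝ) : (num a e).eval t = e - a * t := by
  simp only [num, eval_add, eval_neg, eval_mul, eval_C, eval_X]
  ring

theorem eval_h2 (d t : ℝ) : (h2 d).eval t = t ^ 2 - d := by
  simp [h2]

theorem h2_sq_dvd {δ : ℝ} (hδ : δ ≠ 0) {q : ℝ[X]} (hq : q.eval δ = 0) (hq' : q.eval (-δ) = 0) :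
    h2 (δ ^ 2) ∣ q := by
  have h : h2 (δ ^ 2) = (X - C δ) * (X - C (-δ)) := by
    rw [h2, map_pow, map_neg]
    ring
  rw [h]
  refine IsCoprime.mul_dvd (isCoprime_X_sub_C_of_isUnit_sub ?_) (dvd_iff_isRoot.2 hq)
    (dvd_iff_isRoot.2 hq')
  rw [sub_neg_eq_add, ← two_mul]
  exact (mul_ne_zero two_ne_zero hδ).isUnit

/-- The linear map `q ↦ q / (t² - d)^m`. -/
def divPow (d : ℝ) (m : ℕ) : ℝ[X] →ₗ[ℝ] RatFunc ℝ :=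
  LinearMap.mulRight ℝ (algebraMap ℝ[X] (RatFunc ℝ) (h2 d ^ m))⁻¹ ∘ₗ
    (IsScalarTower.toAlgHom ℝ ℝ[X] (RatFunc ℝ)).toLinearMap

theorem divPow_apply (d : ℝ) (m : ℕ) (q : ℝ[X]) :
    divPow d m q = algebraMap ℝ[X] (RatFunc ℝ) q / algebraMap ℝ[X] (RatFunc ℝ) (h2 d ^ m) :=
  (div_eq_mul_inv _ _).symm

theorem algebraMap_h2_pow_ne_zero (d : ℝ) (m : ℕ) :
    algebraMap ℝ[X] (RatFunc ℝ) (h2 d ^ m) ≠ 0 :=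
  RatFunc.algebraMap_ne_zero (pow_ne_zero _ (h2_ne_zero d))

theorem divPow_injective (d : ℝ) (m : ℕ) : Function.Injective (divPow d m) := fun p q h => by
  rw [divPow_apply, divPow_apply, div_left_inj' (algebraMap_h2_pow_ne_zero d m)] at h
  exact RatFunc.algebraMap_injective ℝ h

theorem divPow_mul_divPow (d : ℝ) (m n : ℕ) (p q : ℝ[X]) :
    divPow d m p * divPow d n q = divPow d (m + n) (p * q) := by
  rw [divPow_apply, divPow_apply, divPow_apply, div_mul_div_comm, ← map_mul, ← map_mul, ← pow_add]

theorem divPow_self_mul_divPow (d : ℝ) (m : ℕ) (p q : ℝ[X]) :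
    divPow d m p * divPow d m q = divPow d (2 * m) (p * q) := by
  rw [divPow_mul_divPow, two_mul]

theorem divPow_pow (d : ℝ) (m i : ℕ) (q : ℝ[X]) :
    divPow d m q ^ i = divPow d (m * i) (q ^ i) := by
  rw [divPow_apply, divPow_apply, div_pow, ← map_pow, ← map_pow, ← pow_mul]

theorem divPow_add_mul_h2_pow (d : ℝ) (m i : ℕ) (q : ℝ[X]) :
    divPow d (m + i) (q * h2 d ^ i) = divPow d m q := by
  rw [divPow_apply, divPow_apply, pow_add, map_mul, map_mul,
    mul_div_mul_right _ _ (algebraMap_h2_pow_ne_zero d i)]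

theorem h3_eq_divPow (a d e : ℝ) : h3 a d e = divPow d 1 (num a e) := by
  rw [divPow_apply, pow_one, h3, num]

theorem ratFunc_X_eq_divPow (d : ℝ) : (RatFunc.X : RatFunc ℝ) = divPow d 0 X := by
  rw [divPow_apply, pow_zero, map_one, div_one, RatFunc.algebraMap_X]

section Parametrization

variable {a d e : ℝ}

/-- The line `y = c` is a component of the cubic if `c ^ 2 = d` and `e = a * c`. -/
theorem eval_num_ne_zero (hP : Irreducible (cubic a d e)) {c : ℝ} (hc : c ^ 2 = d) :
    (num a e).eval c ≠ 0 := by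
  intro h
  have he : e = a * c := by
    rw [eval_num] at h
    linarith
  have hfac : cubic a d e = (MvPolynomial.X 1 - MvPolynomial.C c) *
      (MvPolynomial.X 0 * (MvPolynomial.X 1 + MvPolynomial.C c) + MvPolynomial.C a) := by
    rw [cubic, ← hc, he, map_pow, map_mul]
    ring
  have hunit (p : MvPolynomial (Fin 2) ℝ) (z : Fin 2 → ℝ) (hz : MvPolynomial.eval z p = 0) :
      ¬ IsUnit p := fun hu => not_isUnit_zero (hz ▸ hu.map (MvPolynomial.eval z))
  rcases hP.isUnit_or_isUnit hfac with hu | hu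
  · exact hunit _ ![0, c] (by simp) hu
  · exact hunit _ ![-a, 1 - c] (by simp) hu

/-- The point of the curve with parameter `t`, for `t ^ 2 ≠ d`. -/
def curvePoint (a d e t : ℝ) : Fin 2 → ℝ := ![(num a e).eval t / (t ^ 2 - d), t]

theorem mem_curve_iff {z : Fin 2 → ℝ} :
    z ∈ curve a d e ↔ z 0 * (z 1 ^ 2 - d) = (num a e).eval (z 1) := by
  simp only [curve, Set.mem_ofPred_eq, cubic, eval_num, map_sub, map_add, map_mul,
    map_pow, MvPolynomial.eval_X, MvPolynomial.eval_C]
  constructor <;> intro h <;> linarith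

theorem curvePoint_mem_curve (a e : ℝ) {t : ℝ} (ht : t ^ 2 ≠ d) :
    curvePoint a d e t ∈ curve a d e :=
  mem_curve_iff.2 (div_mul_cancel₀ _ (sub_ne_zero.2 ht))

theorem sq_ne_of_mem_curve (hP : Irreducible (cubic a d e)) {z : Fin 2 → ℝ}
    (hz : z ∈ curve a d e) : z 1 ^ 2 ≠ d := fun h =>
  eval_num_ne_zero hP h (by rw [← mem_curve_iff.1 hz, h, sub_self, mul_zero])

theorem curvePoint_eq_of_mem_curve (hP : Irreducible (cubic a d e)) {z : Fin 2 → ℝ}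
    (hz : z ∈ curve a d e) : curvePoint a d e (z 1) = z := by
  funext i
  fin_cases i
  · exact (div_eq_iff (sub_ne_zero.2 (sq_ne_of_mem_curve hP hz))).2 (mem_curve_iff.1 hz).symm
  · rfl

theorem exists_pullback_eq_divPow (a d e : ℝ) (p : MvPolynomial (Fin 2) ℝ) :
    ∃ (m : ℕ) (q : ℝ[X]), pullback a d e p = divPow d m q ∧ ∀ t, t ^ 2 ≠ d →
      MvPolynomial.eval (curvePoint a d e t) p = q.eval t / (t ^ 2 - d) ^ m := by
  induction p using MvPolynomial.induction_on with
  | C c => exact ⟨0, C c, by simp [pullback, divPow_apply], by simp⟩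
  | add p₁ p₂ ih₁ ih₂ =>
    obtain ⟨m₁, q₁, h₁, h₁'⟩ := ih₁
    obtain ⟨m₂, q₂, h₂, h₂'⟩ := ih₂
    refine ⟨m₁ + m₂, q₁ * h2 d ^ m₂ + q₂ * h2 d ^ m₁, ?_, fun t ht => ?_⟩
    · rw [map_add, map_add, divPow_add_mul_h2_pow, add_comm m₁, divPow_add_mul_h2_pow, h₁, h₂]
    · have := sub_ne_zero.2 ht
      simp only [map_add, h₁' t ht, h₂' t ht, eval_add, eval_mul, eval_pow, eval_h2]
      rw [div_add_div _ _ (pow_ne_zero _ this) (pow_ne_zero _ this), pow_add]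
      ring
  | mul_X p i ih =>
    obtain ⟨m, q, h, h'⟩ := ih
    obtain ⟨n, r, hr, hr'⟩ : ∃ (n : ℕ) (r : ℝ[X]), pullback a d e (.X i) = divPow d n r ∧
        ∀ t, curvePoint a d e t i = r.eval t / (t ^ 2 - d) ^ n := by
      fin_cases i
      · exact ⟨1, num a e, by simp [pullback, h3_eq_divPow], by simp [curvePoint]⟩
      · exact ⟨0, X, by simp [pullback, ratFunc_X_eq_divPow d], by simp [curvePoint]⟩
    refine ⟨m + n, q * r, ?_, fun t ht => ?_⟩
    · rw [map_mul, h, hr, divPow_mul_divPow]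
    · rw [map_mul, MvPolynomial.eval_X, h' t ht, hr' t, eval_mul, pow_add, div_mul_div_comm]

theorem eval_curvePoint {p : MvPolynomial (Fin 2) ℝ} {m : ℕ} {q : ℝ[X]}
    (h : pullback a d e p = divPow d m q) {t : ℝ} (ht : t ^ 2 ≠ d) :
    MvPolynomial.eval (curvePoint a d e t) p = q.eval t / (t ^ 2 - d) ^ m := by
  obtain ⟨n, r, hr, hr'⟩ := exists_pullback_eq_divPow a d e p
  rw [h, ← divPow_add_mul_h2_pow d m n, ← divPow_add_mul_h2_pow d n m, add_comm n] at hr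
  have heq := congrArg (eval t) (divPow_injective _ _ hr)
  simp only [eval_mul, eval_pow, eval_h2] at heq
  have := sub_ne_zero.2 ht
  rw [hr' t ht, div_eq_div_iff (by positivity) (by positivity), heq]

theorem pullback_eq_zero_of_mem_vanishingIdeal {p : MvPolynomial (Fin 2) ℝ}
    (hp : p ∈ MvPolynomial.vanishingIdeal ℝ (curve a d e)) : pullback a d e p = 0 := by
  obtain ⟨m, q, h, h'⟩ := exists_pullback_eq_divPow a d e p
  have hq : h2 d * q = 0 := Polynomial.funext fun t => by
    rw [eval_mul, eval_h2, eval_zero, mul_eq_zero, or_iff_not_imp_left]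
    intro ht
    have hpt := MvPolynomial.mem_vanishingIdeal_iff.1 hp _
      (curvePoint_mem_curve a e (sub_ne_zero.1 ht))
    rw [MvPolynomial.aeval_eq_eval, h' t (sub_ne_zero.1 ht)] at hpt
    exact (div_eq_zero_iff.1 hpt).resolve_right (pow_ne_zero _ ht)
  rw [h, (mul_eq_zero.1 hq).resolve_left (h2_ne_zero d), map_zero]

/-- The map `ℝ[C] → ℝ(t)` induced by the parametrization. -/
def toRatFunc (a d e : ℝ) : CoordRing (curve a d e) →ₐ[ℝ] RatFunc ℝ :=
  Ideal.Quotient.liftₐ _ (pullback a d e) fun _ => pullback_eq_zero_of_mem_vanishingIdeal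

theorem toRatFunc_mk (a d e : ℝ) (p : MvPolynomial (Fin 2) ℝ) :
    toRatFunc a d e (Ideal.Quotient.mk _ p) = pullback a d e p := rfl

theorem toRatFunc_injective (hP : Irreducible (cubic a d e)) :
    Function.Injective (toRatFunc a d e) := by
  rw [injective_iff_map_eq_zero]
  intro f hf
  obtain ⟨p, rfl⟩ := Ideal.Quotient.mk_surjective f
  rw [Ideal.Quotient.eq_zero_iff_mem, MvPolynomial.mem_vanishingIdeal_iff]
  intro z hz
  have hp : pullback a d e p = divPow d 0 0 := hf.trans (map_zero _).symm
  rw [MvPolynomial.aeval_eq_eval, ← curvePoint_eq_of_mem_curve hP hz,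
    eval_curvePoint hp (sq_ne_of_mem_curve hP hz), eval_zero, zero_div]

theorem toRatFunc_monomial {i k : ℕ} (h : i ≤ k) (j : ℕ) :
    toRatFunc a d e (cx a d e ^ i * cy a d e ^ j) =
      divPow d k (num a e ^ i * X ^ j * h2 d ^ (k - i)) := by
  have hx : toRatFunc a d e (cx a d e) = divPow d 1 (num a e) := by
    rw [cx, toRatFunc_mk, pullback, MvPolynomial.aeval_X, ← h3_eq_divPow]
    rfl
  have hy : toRatFunc a d e (cy a d e) = divPow d 0 X := by
    rw [cy, toRatFunc_mk, pullback, MvPolynomial.aeval_X, ← ratFunc_X_eq_divPow]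
    rfl
  obtain ⟨n, rfl⟩ := Nat.exists_eq_add_of_le h
  rw [map_mul, map_pow, map_pow, hx, hy, divPow_pow, divPow_pow, divPow_mul_divPow, one_mul,
    zero_mul, add_zero, Nat.add_sub_cancel_left, divPow_add_mul_h2_pow]

theorem mem_rrSpace_iff_exists_divPow {m : ℕ} {f : RatFunc ℝ} :
    f ∈ rrSpace d m ↔ ∃ q ∈ uniDeg (3 * m), divPow d m q = f := by
  simp only [mem_rrSpace, mem_uniDeg, divPow_apply, eq_comm]

theorem exists_pullback_eq_divPow_of_polyDeg (a d e : ℝ) {m : ℕ} (p : polyDeg m) :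
    ∃ q ∈ uniDeg (3 * m), pullback a d e p = divPow d m q := by
  obtain ⟨q, hq, h⟩ := mem_rrSpace_iff_exists_divPow.1 (pullback_mem a d e p)
  exact ⟨q, hq, h.symm⟩

end Parametrization

/-! ### The numerators of the functions in `ℝ[C]_{≤ k}` and `V^(k)` -/

section NodeSpace

variable {δ u v : ℝ} {k n : ℕ} {N g q : ℝ[X]} {P : Submodule ℝ ℝ[X]}

theorem exists_eq_mul_h2 (hδ : δ ≠ 0) (hq : q ∈ uniDeg (n + 2)) (hqδ : q.eval δ = 0)
    (hqδ' : q.eval (-δ) = 0) : ∃ r ∈ uniDeg n, q = r * h2 (δ ^ 2) := by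
  obtain ⟨r, rfl⟩ := h2_sq_dvd hδ hqδ hqδ'
  refine ⟨r, ?_, mul_comm _ _⟩
  rcases eq_or_ne r 0 with rfl | hr
  · exact zero_mem _
  · rw [mem_uniDeg, natDegree_mul (h2_ne_zero _) hr, h2_natDegree] at hq
    exact mem_uniDeg.2 (by omega)

theorem exists_eq_lineThrough_mul_add (hδ : δ ≠ 0) (hN : N ∈ uniDeg (n + 1)) (hNδ : N.eval δ ≠ 0)
    (hNδ' : N.eval (-δ) ≠ 0) (hq : q ∈ uniDeg (n + 2)) :
    ∃ x y, ∃ r ∈ uniDeg n, q = lineThrough δ x y * N + r * h2 (δ ^ 2) := by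
  obtain ⟨r, hr, h⟩ := exists_eq_mul_h2 (n := n)
    (q := q - lineThrough δ (q.eval δ / N.eval δ) (q.eval (-δ) / N.eval (-δ)) * N) hδ
    (sub_mem hq (add_comm 1 (n + 1) ▸ mul_mem_uniDeg (lineThrough_mem_uniDeg _ _ _) hN))
    (by rw [eval_sub, eval_mul, eval_lineThrough hδ, div_mul_cancel₀ _ hNδ, sub_self])
    (by rw [eval_sub, eval_mul, eval_neg_lineThrough hδ, div_mul_cancel₀ _ hNδ', sub_self])
  exact ⟨_, _, r, hr, by rw [← h, add_sub_cancel]⟩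

theorem pow_mem_uniDeg (hN : N ∈ uniDeg 1) (j : ℕ) : N ^ j ∈ uniDeg j := by
  rw [mem_uniDeg] at *
  simpa only [mul_one] using natDegree_pow_le_of_le j hN

theorem mul_h2_pow_mem (hδ : δ ≠ 0) (hN : N ∈ uniDeg 1) (hNδ : N.eval δ ≠ 0)
    (hNδ' : N.eval (-δ) ≠ 0) (hX : ∀ i ≤ n, X ^ i * h2 (δ ^ 2) ^ k ∈ P)
    (hNP : ∀ i, 1 ≤ i → i < k → N ^ i * h2 (δ ^ 2) ^ (k - i) ∈ P ∧
      N ^ i * X * h2 (δ ^ 2) ^ (k - i) ∈ P)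
    {j : ℕ} (hj : j < k) (hq : q ∈ uniDeg (2 * j + n)) : q * h2 (δ ^ 2) ^ (k - j) ∈ P := by
  induction j generalizing q with
  | zero =>
    rw [mul_zero, zero_add, mem_uniDeg] at hq
    rw [tsub_zero, q.as_sum_range_C_mul_X_pow, Finset.sum_mul]
    refine sum_mem fun i hi => ?_
    rw [mul_assoc, ← smul_eq_C_mul]
    exact P.smul_mem _ (hX i ((Finset.mem_range_succ_iff.1 hi).trans hq))
  | succ j ih =>
    obtain ⟨x, y, r, hr, rfl⟩ := exists_eq_lineThrough_mul_add (N := N ^ (j + 1)) hδ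
      (uniDeg_mono (by omega) (pow_mem_uniDeg hN _)) (by rw [eval_pow]; exact pow_ne_zero _ hNδ)
      (by rw [eval_pow]; exact pow_ne_zero _ hNδ')
      (show q ∈ uniDeg (2 * j + n + 2) by rwa [add_right_comm, ← mul_add_one])
    obtain ⟨hNj, hNXj⟩ := hNP (j + 1) (by omega) hj
    have hr' := ih (by omega) hr
    rw [show k - j = k - (j + 1) + 1 by omega] at hr'
    convert add_mem (add_mem (P.smul_mem ((x + y) / 2) hNj)
      (P.smul_mem ((x - y) / (2 * δ)) hNXj)) hr' using 1
    simp only [lineThrough, smul_eq_C_mul]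
    ring

theorem nodeSpace_le (hδ : δ ≠ 0) (hu : u ≠ 0) (hk : 1 ≤ k) (hN : N ∈ uniDeg 1)
    (hNδ : N.eval δ ≠ 0) (hNδ' : N.eval (-δ) ≠ 0) (hX : ∀ i ≤ n, X ^ i * h2 (δ ^ 2) ^ k ∈ P)
    (hNP : ∀ i, 1 ≤ i → i < k → N ^ i * h2 (δ ^ 2) ^ (k - i) ∈ P ∧
      N ^ i * X * h2 (δ ^ 2) ^ (k - i) ∈ P)
    (hg : g ∈ nodeSpace δ u v (2 * k + n)) (hgδ : g.eval δ ≠ 0) (hgP : g ∈ P) :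
    nodeSpace δ u v (2 * k + n) ≤ P := by
  intro q hq
  obtain ⟨j, rfl⟩ := Nat.exists_eq_add_of_le' hk
  set c := q.eval δ / g.eval δ with hc
  have hmem := sub_mem hq (Submodule.smul_mem _ c hg)
  have hδ0 : (q - c • g).eval δ = 0 := by
    rw [eval_sub, eval_smul, smul_eq_mul, hc, div_mul_cancel₀ _ hgδ, sub_self]
  have hδ0' : (q - c • g).eval (-δ) = 0 := by
    have := (mem_nodeSpace.1 hmem).2
    rw [hδ0, mul_zero] at this
    exact (mul_eq_zero.1 this.symm).resolve_left hu
  obtain ⟨r, hr, h⟩ := exists_eq_mul_h2 (n := 2 * j + n) hδ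
    (by convert (mem_nodeSpace.1 hmem).1 using 2; ring) hδ0 hδ0'
  have hrP := mul_h2_pow_mem hδ hN hNδ hNδ' hX hNP j.lt_succ_self hr
  rw [Nat.add_sub_cancel_left, pow_one, ← h] at hrP
  simpa only [sub_add_cancel] using add_mem hrP (P.smul_mem c hgP)

theorem mul_h2_pow_mem_nodeSpace (u v : ℝ) {i : ℕ} (hi : i ≠ 0) (hq : q ∈ uniDeg (n - 2 * i))
    (hn : 2 * i ≤ n) : q * h2 (δ ^ 2) ^ i ∈ nodeSpace δ u v n := by
  refine mem_nodeSpace.2 ⟨mem_uniDeg.2 ?_, ?_⟩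
  · have := mem_uniDeg.1 hq
    refine natDegree_mul_le.trans ?_
    rw [natDegree_pow, h2_natDegree]
    omega
  · simp [eval_h2, hi]

end NodeSpace

section Generators

variable {a e δ u v : ℝ} {k n : ℕ}

/-- The functions `g`, `x^j` and `x^j y` for `1 ≤ j < k`, and `y^l` for `l ≤ n`. -/
def generators (a d e : ℝ) (k n : ℕ) (g : CoordRing (curve a d e)) :
    Set (CoordRing (curve a d e)) :=
  {g} ∪ {f | ∃ j, 1 ≤ j ∧ j < k ∧ (f = cx a d e ^ j ∨ f = cx a d e ^ j * cy a d e)} ∪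
    {f | ∃ l, l ≤ n ∧ f = cy a d e ^ l}

theorem monomial_mem_nodeSpace (a e δ u v : ℝ) {i j : ℕ} (hi : i < k)
    (hn : i + j + 2 * (k - i) ≤ n) :
    num a e ^ i * X ^ j * h2 (δ ^ 2) ^ (k - i) ∈ nodeSpace δ u v n :=
  mul_h2_pow_mem_nodeSpace u v (by omega) (uniDeg_mono (by omega)
    (mul_mem_uniDeg (pow_mem_uniDeg (num_mem_uniDeg a e) i)
      (pow_mem_uniDeg (mem_uniDeg.2 natDegree_X_le) j))) (by omega)

theorem map_span_generators (hP : Irreducible (cubic a (δ ^ 2) e)) (hδ : δ ≠ 0) (hu : u ≠ 0)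
    (hk : 1 ≤ k) {g : CoordRing (curve a (δ ^ 2) e)} {q : ℝ[X]}
    (hg : toRatFunc a (δ ^ 2) e g = divPow (δ ^ 2) k q) (hq : q ∈ nodeSpace δ u v (2 * k + n))
    (hqδ : q.eval δ ≠ 0) :
    (Submodule.span ℝ (generators a (δ ^ 2) e k n g)).map (toRatFunc a (δ ^ 2) e).toLinearMap =
      (nodeSpace δ u v (2 * k + n)).map (divPow (δ ^ 2) k) := by
  set T := toRatFunc a (δ ^ 2) e
  set D := divPow (δ ^ 2) k
  have hx (j : ℕ) (hj : j < k) :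
      T (cx a (δ ^ 2) e ^ j) = D (num a e ^ j * h2 (δ ^ 2) ^ (k - j)) := by
    simpa using toRatFunc_monomial (a := a) (d := δ ^ 2) (e := e) hj.le 0
  have hxy (j : ℕ) (hj : j < k) : T (cx a (δ ^ 2) e ^ j * cy a (δ ^ 2) e) =
      D (num a e ^ j * X * h2 (δ ^ 2) ^ (k - j)) := by
    simpa using toRatFunc_monomial (a := a) (d := δ ^ 2) (e := e) hj.le 1
  have hy (l : ℕ) : T (cy a (δ ^ 2) e ^ l) = D (X ^ l * h2 (δ ^ 2) ^ k) := by
    simpa using toRatFunc_monomial (a := a) (d := δ ^ 2) (e := e) k.zero_le l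
  apply le_antisymm
  · rw [Submodule.map_le_iff_le_comap, Submodule.span_le]
    rintro f ((rfl | ⟨j, hj, hjk, rfl | rfl⟩) | ⟨l, hl, rfl⟩)
    · exact ⟨q, hq, hg.symm⟩
    · refine ⟨_, ?_, (hx j hjk).symm⟩
      simpa using monomial_mem_nodeSpace a e δ u v (j := 0) hjk (by omega)
    · refine ⟨_, ?_, (hxy j hjk).symm⟩
      simpa using monomial_mem_nodeSpace a e δ u v (j := 1) hjk (by omega)
    · refine ⟨_, ?_, (hy l).symm⟩
      simpa using monomial_mem_nodeSpace a e δ u v (i := 0) (j := l) hk (by omega)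
  · rw [Submodule.map_le_iff_le_comap]
    refine nodeSpace_le hδ hu hk (num_mem_uniDeg a e) (eval_num_ne_zero hP rfl)
      (eval_num_ne_zero hP (neg_sq δ)) (fun l hl => ?_) (fun j hj hjk => ⟨?_, ?_⟩) hq hqδ ?_
    · exact ⟨_, Submodule.subset_span (.inr ⟨l, hl, rfl⟩), hy l⟩
    · exact ⟨_, Submodule.subset_span (.inl (.inr ⟨j, hj, hjk, .inl rfl⟩)), hx j hjk⟩
    · exact ⟨_, Submodule.subset_span (.inl (.inr ⟨j, hj, hjk, .inr rfl⟩)), hxy j hjk⟩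
    · exact ⟨_, Submodule.subset_span (.inl (.inl rfl)), hg⟩

theorem generators_diff {a d e : ℝ} (hk : 1 ≤ k) {g : CoordRing (curve a d e)}
    (hg : cy a d e ^ k ∉ generators a d e k (k - 1) g) :
    generators a d e k k g \ {cy a d e ^ k} = generators a d e k (k - 1) g := by
  have hpow : {f | ∃ l, l ≤ k ∧ f = cy a d e ^ l} =
      insert (cy a d e ^ k) {f | ∃ l, l ≤ k - 1 ∧ f = cy a d e ^ l} := by
    ext f
    simp only [Set.mem_ofPred_eq, Set.mem_insert_iff]
    constructor
    · rintro ⟨l, hl, rfl⟩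
      rcases hl.eq_or_lt with rfl | hl
      · exact .inl rfl
      · exact .inr ⟨l, Nat.le_sub_one_of_lt hl, rfl⟩
    · rintro (rfl | ⟨l, hl, rfl⟩)
      · exact ⟨k, le_rfl, rfl⟩
      · exact ⟨l, hl.trans (k.sub_le 1), rfl⟩
  rw [generators, hpow, Set.union_insert]
  exact Set.insert_sdiff_self_of_notMem hg

theorem map_span_generators_diff (hP : Irreducible (cubic a (δ ^ 2) e)) (hδ : δ ≠ 0) (hu : u ≠ 0)
    (hk : 1 ≤ k) {g : CoordRing (curve a (δ ^ 2) e)} {q : ℝ[X]}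
    (hg : toRatFunc a (δ ^ 2) e g = divPow (δ ^ 2) k q) (hq : q ∈ nodeSpace δ u v (3 * k - 1))
    (hqδ : q.eval δ ≠ 0) :
    (Submodule.span ℝ (generators a (δ ^ 2) e k k g \ {cy a (δ ^ 2) e ^ k})).map
        (toRatFunc a (δ ^ 2) e).toLinearMap =
      (nodeSpace δ u v (3 * k - 1)).map (divPow (δ ^ 2) k) := by
  rw [show 3 * k - 1 = 2 * k + (k - 1) by omega] at *
  have hmap := map_span_generators hP hδ hu hk hg hq hqδ
  rw [generators_diff hk, hmap]
  intro hy
  have hTy := Submodule.mem_map_of_mem (f := (toRatFunc a (δ ^ 2) e).toLinearMap)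
    (Submodule.subset_span (R := ℝ) hy)
  rw [hmap] at hTy
  obtain ⟨r, hr, h⟩ := hTy
  have hr' : r = X ^ k * h2 (δ ^ 2) ^ k := by
    refine divPow_injective _ _ (h.trans ?_)
    simpa using toRatFunc_monomial (a := a) (d := δ ^ 2) (e := e) k.zero_le k
  have hdeg := mem_uniDeg.1 (mem_nodeSpace.1 hr).1
  rw [hr', (monic_X_pow k).natDegree_mul ((h2_monic _).pow k), natDegree_X_pow, natDegree_pow,
    h2_natDegree] at hdeg
  omega

/-- The numerators `q` of the functions `q / (t² - δ²)^k` in `ℝ[C]_{≤ k}`, for `d = δ²`. -/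
def coordNumerators (a e δ : ℝ) (k n : ℕ) : Submodule ℝ ℝ[X] :=
  nodeSpace δ ((num a e).eval δ ^ k) ((num a e).eval (-δ) ^ k) n

/-- The numerators `q` of the functions `q / (t² - δ²)^k` in `V^(k)`, for `d = δ²`. -/
def localNumerators (a e δ : ℝ) (k n : ℕ) : Submodule ℝ ℝ[X] :=
  nodeSpace δ ((num a e).eval δ ^ k) (-(num a e).eval (-δ) ^ k) n

theorem num_pow_mem_coordNumerators (a e δ : ℝ) (hn : k ≤ n) :
    num a e ^ k ∈ coordNumerators a e δ k n :=
  mem_nodeSpace.2 ⟨uniDeg_mono hn (pow_mem_uniDeg (num_mem_uniDeg a e) k), by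
    rw [eval_pow, eval_pow, mul_comm]⟩

theorem num_pow_mul_X_mem_localNumerators (a e δ : ℝ) (hn : k + 1 ≤ n) :
    num a e ^ k * X ∈ localNumerators a e δ k n :=
  mem_nodeSpace.2 ⟨uniDeg_mono hn (mul_mem_uniDeg (pow_mem_uniDeg (num_mem_uniDeg a e) k)
    (mem_uniDeg.2 natDegree_X_le)), by
      simp only [eval_mul, eval_pow, eval_X]
      ring⟩

theorem toRatFunc_cx_pow (a d e : ℝ) (k : ℕ) :
    toRatFunc a d e (cx a d e ^ k) = divPow d k (num a e ^ k) := by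
  simpa using toRatFunc_monomial (a := a) (d := d) (e := e) le_rfl 0

theorem toRatFunc_cx_pow_mul_cy (a d e : ℝ) (k : ℕ) :
    toRatFunc a d e (cx a d e ^ k * cy a d e) = divPow d k (num a e ^ k * X) := by
  simpa using toRatFunc_monomial (a := a) (d := d) (e := e) le_rfl 1

theorem mk_monomial (a d e c : ℝ) (s : Fin 2 →₀ ℕ) :
    Ideal.Quotient.mk (MvPolynomial.vanishingIdeal ℝ (curve a d e)) (.monomial s c) =
      c • (cx a d e ^ s 0 * cy a d e ^ s 1) := by
  rw [MvPolynomial.monomial_eq, Finsupp.prod_fintype _ _ fun _ => pow_zero _, Fin.prod_univ_two,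
    map_mul, map_mul, map_pow, map_pow]
  exact (Algebra.smul_def (A := CoordRing (curve a d e)) c _).symm

theorem map_coordDeg_le (a e δ : ℝ) (hk : 1 ≤ k) :
    (coordDeg (curve a (δ ^ 2) e) k).map (toRatFunc a (δ ^ 2) e).toLinearMap ≤
      (coordNumerators a e δ k (3 * k)).map (divPow (δ ^ 2) k) := by
  rw [Submodule.map_le_iff_le_comap]
  intro f hf
  obtain ⟨p, hp, rfl⟩ := mem_coordDeg _ hf
  rw [p.as_sum, map_sum]
  refine sum_mem fun s hs => ?_
  rw [mk_monomial]
  refine Submodule.smul_mem _ _ ?_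
  have hs' : s 0 + s 1 ≤ k := by
    have := (MvPolynomial.le_totalDegree hs).trans hp
    rwa [Finsupp.sum_fintype _ _ fun _ => rfl, Fin.sum_univ_two] at this
  refine ⟨_, ?_, (toRatFunc_monomial (by omega) (s 1)).symm⟩
  rcases Nat.lt_or_ge (s 0) k with h | h
  · exact monomial_mem_nodeSpace a e δ _ _ h (by omega)
  · rw [show s 0 = k by omega, show s 1 = 0 by omega, pow_zero, mul_one, tsub_self, pow_zero,
      mul_one]
    exact num_pow_mem_coordNumerators a e δ (by omega)

theorem span_basisB_le_coordDeg (a d e : ℝ) (k : ℕ) :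
    Submodule.span ℝ (basisB a d e k) ≤ coordDeg (curve a d e) k := by
  have hmem {i j : ℕ} (h : i + j ≤ k) := monomial_mem a d e h
  rw [Submodule.span_le]
  rintro f ((rfl | ⟨j, -, hjk, rfl | rfl⟩) | ⟨l, hl, rfl⟩)
  · simpa using hmem (i := k) (j := 0) le_rfl
  · simpa using hmem (i := j) (j := 0) hjk.le
  · simpa using hmem (i := j) (j := 1) hjk
  · simpa using hmem (i := 0) (j := l) (by omega)

section Maps

variable (hP : Irreducible (cubic a (δ ^ 2) e)) (hδ : δ ≠ 0) (hk : 1 ≤ k)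

include hP hδ hk

theorem map_coordDeg :
    (coordDeg (curve a (δ ^ 2) e) k).map (toRatFunc a (δ ^ 2) e).toLinearMap =
      (coordNumerators a e δ k (3 * k)).map (divPow (δ ^ 2) k) := by
  refine le_antisymm (map_coordDeg_le a e δ hk) ?_
  have hu := pow_ne_zero k (eval_num_ne_zero hP rfl)
  rw [show 3 * k = 2 * k + k by ring, coordNumerators, ← map_span_generators hP hδ hu hk
    (toRatFunc_cx_pow _ _ _ k) (num_pow_mem_coordNumerators a e δ (by omega)) (by rwa [eval_pow])]
  exact Submodule.map_mono (span_basisB_le_coordDeg a (δ ^ 2) e k)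

theorem map_span_basisB_diff :
    (Submodule.span ℝ (basisB a (δ ^ 2) e k \ {cy a (δ ^ 2) e ^ k})).map
        (toRatFunc a (δ ^ 2) e).toLinearMap =
      (coordNumerators a e δ k (3 * k - 1)).map (divPow (δ ^ 2) k) :=
  have hu := pow_ne_zero k (eval_num_ne_zero hP rfl)
  map_span_generators_diff hP hδ hu hk (toRatFunc_cx_pow _ _ _ k)
    (num_pow_mem_coordNumerators a e δ (by omega)) (by rwa [eval_pow])

theorem map_spaceV :
    (spaceV a (δ ^ 2) e k).map (toRatFunc a (δ ^ 2) e).toLinearMap =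
      (localNumerators a e δ k (3 * k)).map (divPow (δ ^ 2) k) := by
  have hu := pow_ne_zero k (eval_num_ne_zero hP rfl)
  rw [show 3 * k = 2 * k + k by ring]
  exact map_span_generators hP hδ hu hk (toRatFunc_cx_pow_mul_cy _ _ _ k)
    (num_pow_mul_X_mem_localNumerators a e δ (by omega))
    (by rw [eval_mul, eval_pow, eval_X]; exact mul_ne_zero hu hδ)

theorem map_span_basisBt_diff :
    (Submodule.span ℝ (basisBt a (δ ^ 2) e k \ {cy a (δ ^ 2) e ^ k})).map
        (toRatFunc a (δ ^ 2) e).toLinearMap =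
      (localNumerators a e δ k (3 * k - 1)).map (divPow (δ ^ 2) k) :=
  have hu := pow_ne_zero k (eval_num_ne_zero hP rfl)
  map_span_generators_diff hP hδ hu hk (toRatFunc_cx_pow_mul_cy _ _ _ k)
    (num_pow_mul_X_mem_localNumerators a e δ (by omega))
    (by rw [eval_mul, eval_pow, eval_X]; exact mul_ne_zero hu hδ)

end Maps

end Generators

/-! ### Transport of forms to univariate polynomials -/

theorem exists_linearEquiv_of_map_eq {R M N K : Type*} [Ring R] [AddCommGroup M] [AddCommGroup N]
    [AddCommGroup K] [Module R M] [Module R N] [Module R K] {f : M →ₗ[R] K}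
    (hf : Function.Injective f) {g : N →ₗ[R] K} (hg : Function.Injective g)
    {W : Submodule R M} {P : Submodule R N} (h : W.map f = P.map g) :
    ∃ E : W ≃ₗ[R] P, ∀ x, g (E x) = f x := by
  let F := P.equivMapOfInjective g hg
  let E := W.equivMapOfInjective f hf ≪≫ₗ LinearEquiv.ofEq _ _ h
  exact ⟨E ≪≫ₗ F.symm, fun x => congrArg Subtype.val (F.apply_symm_apply (E x))⟩

section Transport

variable {W : Type*} [AddCommGroup W] [Module ℝ W] {B : LinearMap.BilinForm ℝ W}
  {P : Submodule ℝ ℝ[X]} {E : W ≃ₗ[ℝ] P} {l : ℝ[X] →ₗ[ℝ] ℝ}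

theorem isPos_iff_isSquarePositive (hB : ∀ f g, B f g = l (E f * E g)) :
    IsPos B ↔ IsSquarePositive l P :=
  ⟨fun h q hq => by simpa [hB] using h (E.symm ⟨q, hq⟩), fun h f => hB f f ▸ h _ (E f).2⟩

theorem mem_ker_iff_inKernel (hB : ∀ f g, B f g = l (E f * E g)) {f : W} :
    f ∈ LinearMap.ker B ↔ InKernel l P (E f) := by
  constructor
  · refine fun h => ⟨(E f).2, fun r hr => ?_⟩
    simpa [hB] using LinearMap.congr_fun (LinearMap.mem_ker.1 h) (E.symm ⟨r, hr⟩)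
  · exact fun h => LinearMap.mem_ker.2 (LinearMap.ext fun g => (hB f g).trans (h.2 _ (E g).2))

theorem formRank_eq_restrict_iff_exists_inKernel [FiniteDimensional ℝ P]
    (hB : ∀ f g, B f g = l (E f * E g)) (hpos : IsPos B) {U : Submodule ℝ W} {n : ℕ}
    (hU : ∀ f, f ∈ U ↔ (E f : ℝ[X]).coeff n = 0) {q₀ : ℝ[X]} (hq₀ : q₀ ∈ P)
    (hq₀n : q₀.coeff n ≠ 0) :
    formRank B = formRank (B.restrict U) ↔ ∃ q, InKernel l P q ∧ q.coeff n ≠ 0 := by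
  have : FiniteDimensional ℝ W := E.symm.finiteDimensional
  let φ : W →ₗ[ℝ] ℝ := lcoeff ℝ n ∘ₗ P.subtype ∘ₗ E.toLinearMap
  obtain rfl : U = LinearMap.ker φ := Submodule.ext hU
  have hφ : φ ≠ 0 := fun h => hq₀n (by
    simpa [φ] using LinearMap.congr_fun h (E.symm ⟨q₀, hq₀⟩))
  have hsymm : LinearMap.IsSymm B := ⟨fun f g => by
    rw [RingHom.id_apply, hB, hB, mul_comm]⟩
  rw [formRank_eq_restrict_ker_iff hpos hsymm hφ]
  constructor
  · exact fun ⟨f, hf, hfn⟩ => ⟨E f, (mem_ker_iff_inKernel hB).1 hf, hfn⟩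
  · rintro ⟨q, hq, hqn⟩
    obtain ⟨f, hf⟩ := E.surjective ⟨q, hq.1⟩
    obtain rfl : (E f : ℝ[X]) = q := congrArg Subtype.val hf
    exact ⟨f, (mem_ker_iff_inKernel hB).2 hq, hqn⟩

end Transport

/-! ### Functionals on the curve as functionals on univariate polynomials -/

/-- `l` is an extension to `ℝ[t]` of the functional `q ↦ L (q / (t² - d)^(2k))`, which is defined
on the numerators `q` of the functions in `ℝ[C]_{≤ 2k}`. -/
def Represents (a d e : ℝ) {k : ℕ} (L : polyDeg (2 * k) →ₗ[ℝ] ℝ) (l : ℝ[X] →ₗ[ℝ] ℝ) : Prop :=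
  ∀ (p : polyDeg (2 * k)) (Q : ℝ[X]),
    pullback a d e (p : MvPolynomial (Fin 2) ℝ) = divPow d (2 * k) Q → l Q = L p

section Extension

variable {a d e : ℝ} {k : ℕ} {L : polyDeg (2 * k) →ₗ[ℝ] ℝ} {l : ℝ[X] →ₗ[ℝ] ℝ}
  {Lhat : rrSpace d (2 * k) →ₗ[ℝ] ℝ}

theorem divMap_coe (d : ℝ) (Q : uniDeg (6 * k)) :
    (divMap d k Q : RatFunc ℝ) = divPow d (2 * k) (Q : ℝ[X]) :=
  (divPow_apply _ _ _).symm

theorem divMap_bijective (d : ℝ) (k : ℕ) : Function.Bijective (divMap d k) := by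
  constructor
  · intro p q h
    have h' := congrArg Subtype.val h
    rw [divMap_coe, divMap_coe] at h'
    exact Subtype.ext (divPow_injective _ _ h')
  · rintro ⟨f, hf⟩
    obtain ⟨q, hq, rfl⟩ := mem_rrSpace_iff_exists_divPow.1 hf
    rw [← mul_assoc] at hq
    exact ⟨⟨q, hq⟩, Subtype.ext (divMap_coe d _)⟩

theorem exists_extend_uniFunctional (Lhat : rrSpace d (2 * k) →ₗ[ℝ] ℝ) :
    ∃ l : ℝ[X] →ₗ[ℝ] ℝ, ∀ Q : uniDeg (6 * k), uniFunctional d Lhat Q = l Q :=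
  (LinearMap.exists_extend (uniFunctional d Lhat)).imp fun _ hl Q => LinearMap.congr_fun hl.symm Q

theorem exists_uniFunctional_eq (d : ℝ) (k : ℕ) (l : ℝ[X] →ₗ[ℝ] ℝ) :
    ∃ Lhat : rrSpace d (2 * k) →ₗ[ℝ] ℝ, ∀ Q : uniDeg (6 * k), uniFunctional d Lhat Q = l Q := by
  let E := LinearEquiv.ofBijective (divMap d k) (divMap_bijective d k)
  exact ⟨l.domRestrict (uniDeg (6 * k)) ∘ₗ E.symm.toLinearMap,
    fun Q => congrArg (fun q : uniDeg (6 * k) => l q) (E.symm_apply_apply Q)⟩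

theorem apply_eq_of_uniFunctional_eq (hl : ∀ Q : uniDeg (6 * k), uniFunctional d Lhat Q = l Q)
    {f : RatFunc ℝ} (hf : f ∈ rrSpace d (2 * k)) {Q : ℝ[X]} (hQ : f = divPow d (2 * k) Q) :
    Lhat ⟨f, hf⟩ = l Q := by
  obtain ⟨q, hq⟩ := (divMap_bijective d k).2 ⟨f, hf⟩
  have hqQ : (q : ℝ[X]) = Q := divPow_injective d (2 * k) (by
    rw [← divMap_coe, hq, ← hQ])
  rw [← hqQ, ← hl q, ← hq]
  rfl

theorem isExtension_iff (hl : ∀ Q : uniDeg (6 * k), uniFunctional d Lhat Q = l Q) :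
    IsExtension a d e L Lhat ↔ Represents a d e L l := by
  constructor
  · intro h p Q hQ
    rw [← apply_eq_of_uniFunctional_eq hl (pullback_mem a d e p) hQ, h p]
  · intro h p
    obtain ⟨q, -, hq⟩ := exists_pullback_eq_divPow_of_polyDeg a d e p
    rw [apply_eq_of_uniFunctional_eq hl (pullback_mem a d e p) hq, h p q hq]

theorem exists_represents (hP : Irreducible (cubic a d e))
    (hL : VanishesOnIdeal (curve a d e) L) : ∃ l, Represents a d e L l := by
  let T : polyDeg (2 * k) →ₗ[ℝ] rrSpace d (2 * k) :=
    ((pullback a d e).toLinearMap ∘ₗ (polyDeg (2 * k)).subtype).codRestrict _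
      fun p => pullback_mem a d e p
  have hker : L ∈ (LinearMap.ker T).dualAnnihilator := by
    rw [Submodule.mem_dualAnnihilator]
    intro p hp
    have hp' : toRatFunc a d e (Ideal.Quotient.mk _ p) = 0 := congrArg Subtype.val hp
    exact hL p (Ideal.Quotient.eq_zero_iff_mem.1
      ((map_eq_zero_iff _ (toRatFunc_injective hP)).1 hp'))
  rw [← LinearMap.range_dualMap_eq_dualAnnihilator_ker] at hker
  obtain ⟨Lhat, h⟩ := hker
  obtain ⟨l, hl⟩ := exists_extend_uniFunctional Lhat
  exact ⟨l, (isExtension_iff hl).1 fun p => LinearMap.congr_fun h p⟩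

theorem isPos_rrForm_iff (hl : ∀ Q : uniDeg (6 * k), uniFunctional d Lhat Q = l Q) :
    IsPos (rrForm d Lhat) ↔ IsSquarePositive l (uniDeg (3 * k)) := by
  have hmap : (rrSpace d k).map LinearMap.id = (uniDeg (3 * k)).map (divPow d k) := by
    ext f
    rw [Submodule.map_id, mem_rrSpace_iff_exists_divPow, Submodule.mem_map]
  obtain ⟨E, hE⟩ := exists_linearEquiv_of_map_eq Function.injective_id (divPow_injective d k) hmap
  refine isPos_iff_isSquarePositive (E := E) fun f g => apply_eq_of_uniFunctional_eq hl _ ?_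
  rw [← divPow_self_mul_divPow, hE, hE]
  rfl

theorem generatingNonvanishing_iff {l' : uniDeg (6 * k) →ₗ[ℝ] ℝ}
    (hl : ∀ Q : uniDeg (6 * k), l' Q = l Q) :
    GeneratingNonvanishing d l' ↔ ∃ p : ℝ[X], IsMinimalKernel l (3 * k) p ∧
      p.eval (√d) ≠ 0 ∧ p.eval (-√d) ≠ 0 := by
  have hker (p : uniDeg (3 * k)) :
      p ∈ LinearMap.ker (uniForm l') ↔ InKernel l (uniDeg (3 * k)) p :=
    mem_ker_iff_inKernel (E := LinearEquiv.refl ℝ _) fun _ _ => hl _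
  constructor
  · rintro ⟨p, ⟨hp, hp0, hmin⟩, hpd⟩
    refine ⟨p, ⟨(hker p).1 hp, fun h => hp0 (Subtype.ext h), fun q hq hq0 => ?_⟩, hpd⟩
    exact hmin ⟨q, hq.1⟩ ((hker _).2 hq) fun h => hq0 (congrArg Subtype.val h)
  · rintro ⟨p, ⟨hp, hp0, hmin⟩, hpd⟩
    refine ⟨⟨p, hp.1⟩, ⟨(hker _).2 hp, fun h => hp0 (congrArg Subtype.val h), fun q hq hq0 => ?_⟩,
      hpd⟩
    exact hmin q ((hker q).1 hq) fun h => hq0 (Subtype.ext h)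

theorem Represents.inducedFunctional_eq (hl : Represents a d e L l)
    (hL : VanishesOnIdeal (curve a d e) L) {f : CoordRing (curve a d e)}
    (hf : f ∈ coordDeg (curve a d e) (2 * k)) {Q : ℝ[X]}
    (hQ : toRatFunc a d e f = divPow d (2 * k) Q) :
    inducedFunctional (curve a d e) L hL ⟨f, hf⟩ = l Q := by
  obtain ⟨p, rfl⟩ := hf
  exact (inducedFunctional_apply _ _ _ p).trans (hl p Q hQ).symm

theorem Represents.coordForm_eq (hl : Represents a d e L l)
    (hL : VanishesOnIdeal (curve a d e) L) {f g : coordDeg (curve a d e) k} {q r : ℝ[X]}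
    (hf : divPow d k q = toRatFunc a d e f) (hg : divPow d k r = toRatFunc a d e g) :
    coordForm (curve a d e) L hL f g = l (q * r) :=
  hl.inducedFunctional_eq hL _ (by rw [map_mul, ← hf, ← hg, divPow_self_mul_divPow])

theorem Represents.localForm_eq (hl : Represents a d e L l)
    (hL : VanishesOnIdeal (curve a d e) L) (hk : 1 ≤ k) {f g : spaceV a d e k} {q r : ℝ[X]}
    (hf : divPow d k q = toRatFunc a d e f) (hg : divPow d k r = toRatFunc a d e g) :
    localForm a d e hk L hL f g = l (q * r) :=
  hl.inducedFunctional_eq hL _ (by rw [map_mul, ← hf, ← hg, divPow_self_mul_divPow])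

end Extension

section Forms

variable {a e δ : ℝ} {k : ℕ} {L : polyDeg (2 * k) →ₗ[ℝ] ℝ} {l : ℝ[X] →ₗ[ℝ] ℝ}

theorem exists_coordDeg_linearEquiv (hP : Irreducible (cubic a (δ ^ 2) e)) (hδ : δ ≠ 0)
    (hk : 1 ≤ k) : ∃ E : coordDeg (curve a (δ ^ 2) e) k ≃ₗ[ℝ] coordNumerators a e δ k (3 * k),
      ∀ f, divPow (δ ^ 2) k (E f) = toRatFunc a (δ ^ 2) e f :=
  exists_linearEquiv_of_map_eq (toRatFunc_injective hP) (divPow_injective _ _)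
    (map_coordDeg hP hδ hk)

theorem exists_spaceV_linearEquiv (hP : Irreducible (cubic a (δ ^ 2) e)) (hδ : δ ≠ 0)
    (hk : 1 ≤ k) : ∃ E : spaceV a (δ ^ 2) e k ≃ₗ[ℝ] localNumerators a e δ k (3 * k),
      ∀ f, divPow (δ ^ 2) k (E f) = toRatFunc a (δ ^ 2) e f :=
  exists_linearEquiv_of_map_eq (toRatFunc_injective hP) (divPow_injective _ _)
    (map_spaceV hP hδ hk)

theorem formRank_eq_restrict_submoduleOf_iff (hP : Irreducible (cubic a (δ ^ 2) e)) (hk : 1 ≤ k)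
    {u v : ℝ} {W U : Submodule ℝ (CoordRing (curve a (δ ^ 2) e))} {B : LinearMap.BilinForm ℝ W}
    {E : W ≃ₗ[ℝ] nodeSpace δ u v (3 * k)}
    (hE : ∀ f, divPow (δ ^ 2) k (E f) = toRatFunc a (δ ^ 2) e f)
    (hB : ∀ f g, B f g = l (E f * E g)) (hpos : IsPos B)
    (hU : U.map (toRatFunc a (δ ^ 2) e).toLinearMap =
      (nodeSpace δ u v (3 * k - 1)).map (divPow (δ ^ 2) k)) :
    formRank B = formRank (B.restrict (U.submoduleOf W)) ↔
      ∃ q, InKernel l (nodeSpace δ u v (3 * k)) q ∧ q.coeff (3 * k) ≠ 0 := by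
  have : FiniteDimensional ℝ (nodeSpace δ u v (3 * k)) :=
    Submodule.finiteDimensional_inf_left _ _
  have hq₀ : X ^ k * h2 (δ ^ 2) ^ k ∈ nodeSpace δ u v (3 * k) := by
    simpa using monomial_mem_nodeSpace a e δ u v (i := 0) (j := k) hk (by omega)
  have hmonic : (X ^ k * h2 (δ ^ 2) ^ k).Monic := (monic_X_pow k).mul ((h2_monic _).pow k)
  have hdeg : (X ^ k * h2 (δ ^ 2) ^ k).natDegree = 3 * k := by
    rw [(monic_X_pow k).natDegree_mul ((h2_monic _).pow k), natDegree_X_pow, natDegree_pow,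
      h2_natDegree]
    ring
  refine formRank_eq_restrict_iff_exists_inKernel hB hpos (fun f => ?_) hq₀ ?_
  · calc
      f ∈ U.submoduleOf W ↔ toRatFunc a (δ ^ 2) e f ∈ U.map (toRatFunc a (δ ^ 2) e).toLinearMap :=
        ((toRatFunc_injective hP).mem_set_image (s := U)).symm
      _ ↔ (E f : ℝ[X]) ∈ nodeSpace δ u v (3 * k - 1) := by
        rw [hU, ← hE]
        exact (divPow_injective _ _).mem_set_image
      _ ↔ (E f : ℝ[X]).coeff (3 * k) = 0 := by
        have hEf := mem_nodeSpace.1 (E f).2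
        rw [mem_nodeSpace, mem_uniDeg, and_iff_left hEf.2]
        refine ⟨fun h => coeff_eq_zero_of_natDegree_lt (by omega), fun h => ?_⟩
        exact natDegree_le_pred (mem_uniDeg.1 hEf.1) h
  · rw [← hdeg, hmonic.coeff_natDegree]
    exact one_ne_zero

theorem isPos_coordForm_iff (hP : Irreducible (cubic a (δ ^ 2) e)) (hδ : δ ≠ 0) (hk : 1 ≤ k)
    (hl : Represents a (δ ^ 2) e L l) (hL : VanishesOnIdeal (curve a (δ ^ 2) e) L) :
    IsPos (coordForm (curve a (δ ^ 2) e) L hL) ↔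
      IsSquarePositive l (coordNumerators a e δ k (3 * k)) :=
  have ⟨_, hE⟩ := exists_coordDeg_linearEquiv hP hδ hk
  isPos_iff_isSquarePositive fun f g => hl.coordForm_eq hL (hE f) (hE g)

theorem isPos_localForm_iff (hP : Irreducible (cubic a (δ ^ 2) e)) (hδ : δ ≠ 0) (hk : 1 ≤ k)
    (hl : Represents a (δ ^ 2) e L l) (hL : VanishesOnIdeal (curve a (δ ^ 2) e) L) :
    IsPos (localForm a (δ ^ 2) e hk L hL) ↔
      IsSquarePositive l (localNumerators a e δ k (3 * k)) :=
  have ⟨_, hE⟩ := exists_spaceV_linearEquiv hP hδ hk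
  isPos_iff_isSquarePositive fun f g => hl.localForm_eq hL hk (hE f) (hE g)

theorem rankCondition_iff (hP : Irreducible (cubic a (δ ^ 2) e)) (hδ : δ ≠ 0) (hk : 1 ≤ k)
    (hl : Represents a (δ ^ 2) e L l) (hL : VanishesOnIdeal (curve a (δ ^ 2) e) L)
    (hcoord : IsPos (coordForm (curve a (δ ^ 2) e) L hL))
    (hlocal : IsPos (localForm a (δ ^ 2) e hk L hL)) :
    RankCondition a (δ ^ 2) e hk L hL ↔
      (∃ q, InKernel l (coordNumerators a e δ k (3 * k)) q ∧ q.coeff (3 * k) ≠ 0) ∨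
        ∃ q, InKernel l (localNumerators a e δ k (3 * k)) q ∧ q.coeff (3 * k) ≠ 0 := by
  obtain ⟨E, hE⟩ := exists_coordDeg_linearEquiv hP hδ hk
  obtain ⟨F, hF⟩ := exists_spaceV_linearEquiv hP hδ hk
  exact or_congr
    (formRank_eq_restrict_submoduleOf_iff hP hk hE
      (fun f g => hl.coordForm_eq hL (hE f) (hE g)) hcoord (map_span_basisB_diff hP hδ hk))
    (formRank_eq_restrict_submoduleOf_iff hP hk hF
      (fun f g => hl.localForm_eq hL hk (hF f) (hF g)) hlocal (map_span_basisBt_diff hP hδ hk))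

theorem mem_ker_polyForm_iff (hP : Irreducible (cubic a (δ ^ 2) e)) (hδ : δ ≠ 0) (hk : 1 ≤ k)
    (hl : Represents a (δ ^ 2) e L l) (hL : VanishesOnIdeal (curve a (δ ^ 2) e) L)
    (h0 : ∀ q ∈ coordNumerators a e δ k (3 * k), l (q * q) = 0 → q = 0) (f : polyDeg k) :
    f ∈ LinearMap.ker (polyForm L) ↔
      (f : MvPolynomial (Fin 2) ℝ) ∈ MvPolynomial.vanishingIdeal ℝ (curve a (δ ^ 2) e) := by
  constructor
  · intro hf
    have hfmem : toCoord (curve a (δ ^ 2) e) k f ∈ coordDeg (curve a (δ ^ 2) e) k :=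
      LinearMap.mem_range_self _ f
    obtain ⟨q, hq, hqf⟩ := (map_coordDeg hP hδ hk).le (Submodule.mem_map_of_mem hfmem)
    have hqf' : divPow (δ ^ 2) k q = pullback a (δ ^ 2) e f := hqf
    have hqq : l (q * q) = 0 := (hl ⟨f * f, polyDeg_mul k f f.2 f f.2⟩ (q * q) (by
      rw [map_mul, ← hqf', divPow_self_mul_divPow])).trans
        (LinearMap.congr_fun (LinearMap.mem_ker.1 hf) f)
    rw [h0 q hq hqq, map_zero] at hqf'
    exact Ideal.Quotient.eq_zero_iff_mem.1
      ((map_eq_zero_iff _ (toRatFunc_injective hP)).1 hqf'.symm)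
  · exact fun hf => LinearMap.mem_ker.2 (LinearMap.ext fun g => hL _ (Ideal.mul_mem_right _ _ hf))

theorem exists_ne_zero_of_singular (hP : Irreducible (cubic a (δ ^ 2) e)) (hδ : δ ≠ 0)
    (hk : 1 ≤ k) (hl : Represents a (δ ^ 2) e L l)
    (hL : VanishesOnIdeal (curve a (δ ^ 2) e) L)
    (hsing : ¬ IsNonsingular a (δ ^ 2) e hk L hL) :
    ∃ q, (q ∈ coordNumerators a e δ k (3 * k) ∨ q ∈ localNumerators a e δ k (3 * k)) ∧
      q ≠ 0 ∧ l (q * q) = 0 := by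
  by_contra! hc
  have h0 {q : ℝ[X]} (hq : q ∈ coordNumerators a e δ k (3 * k) ∨
      q ∈ localNumerators a e δ k (3 * k)) (hqq : l (q * q) = 0) : q = 0 :=
    not_not.1 fun hne => hc q hq hne hqq
  refine hsing ⟨mem_ker_polyForm_iff hP hδ hk hl hL fun q hq => h0 (.inl hq),
    (Submodule.eq_bot_iff _).2 fun f hf => ?_⟩
  obtain ⟨E, hE⟩ := exists_spaceV_linearEquiv hP hδ hk
  have hker := (mem_ker_iff_inKernel fun f g => hl.localForm_eq hL hk (hE f) (hE g)).1 hf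
  exact (map_eq_zero_iff _ E.injective).1
    (Subtype.ext (h0 (.inr hker.1) (hker.2 _ hker.1)))

end Forms

/-! ### Measures on the curve -/

section Moments

variable {a d e : ℝ} {k : ℕ} {L : polyDeg (2 * k) →ₗ[ℝ] ℝ}

theorem isMomentFunctional_of_represents_atomic {S : Finset ℝ} {w : ℝ → ℝ}
    (hw : ∀ t ∈ S, 0 ≤ w t) (hS : ∀ t ∈ S, t ^ 2 ≠ d) (h : Represents a d e L (atomic S w)) :
    IsMomentFunctional (curve a d e) L := by
  refine ⟨∑ t ∈ S, ENNReal.ofReal (w t * (t ^ 2 - d) ^ (2 * k)) •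
    Measure.dirac (curvePoint a d e t), ?_, fun p => ?_⟩
  · rw [Measure.finsetSum_apply]
    refine Finset.sum_eq_zero fun t ht => ?_
    rw [Measure.smul_apply, Measure.dirac_apply, Set.indicator_of_notMem
      (Set.notMem_compl_iff.2 (curvePoint_mem_curve a e (hS t ht))), smul_zero]
  have hint (t : ℝ) (_ : t ∈ S) : Integrable (fun z => MvPolynomial.eval z p.1)
      (ENNReal.ofReal (w t * (t ^ 2 - d) ^ (2 * k)) • Measure.dirac (curvePoint a d e t)) :=
    (integrable_dirac enorm_lt_top).smul_measure ENNReal.ofReal_ne_top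
  obtain ⟨Q, -, hQ⟩ := exists_pullback_eq_divPow_of_polyDeg a d e p
  refine ⟨integrable_finsetSum_measure.2 hint, ?_⟩
  rw [integral_finsetSum_measure hint, ← h p Q hQ, atomic_apply]
  refine Finset.sum_congr rfl fun t ht => ?_
  have hpow : 0 < (t ^ 2 - d) ^ (2 * k) :=
    (even_two_mul k).pow_pos (sub_ne_zero.2 (hS t ht))
  rw [integral_smul_measure, integral_dirac, eval_curvePoint hQ (hS t ht), smul_eq_mul,
    ENNReal.toReal_ofReal (mul_nonneg (hw t ht) hpow.le)]
  field_simp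

theorem IsMomentFunctional.exists_measure (hP : Irreducible (cubic a d e))
    (hL : IsMomentFunctional (curve a d e) L) :
    ∃ ν : Measure ℝ, (∀ᵐ t ∂ν, t ^ 2 ≠ d) ∧ ∀ (p : polyDeg (2 * k)) (Q : ℝ[X]),
      pullback a d e p = divPow d (2 * k) Q →
        Integrable (fun t => Q.eval t / (t ^ 2 - d) ^ (2 * k)) ν ∧
          L p = ∫ t, Q.eval t / (t ^ 2 - d) ^ (2 * k) ∂ν := by
  obtain ⟨μ, hμ, hint⟩ := hL
  have hcurve : ∀ᵐ z ∂μ, z ∈ curve a d e := hμ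
  have hmeas : Measurable fun z : Fin 2 → ℝ => z 1 := measurable_pi_apply 1
  refine ⟨μ.map fun z => z 1, ?_, fun p Q hQ => ?_⟩
  · have hset : MeasurableSet {t : ℝ | t ^ 2 ≠ d} :=
      (measurableSet_singleton d).compl.preimage (by fun_prop)
    exact (ae_map_iff hmeas.aemeasurable hset).2
      (hcurve.mono fun z hz => sq_ne_of_mem_curve hP hz)
  have hf : AEStronglyMeasurable (fun t => Q.eval t / (t ^ 2 - d) ^ (2 * k))
      (μ.map fun z => z 1) :=
    (Q.continuous.measurable.div (by fun_prop)).aestronglyMeasurable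
  have hae : (fun z => MvPolynomial.eval z p.1) =ᵐ[μ]
      fun z => Q.eval (z 1) / (z 1 ^ 2 - d) ^ (2 * k) := hcurve.mono fun z hz => by
    simpa only [curvePoint_eq_of_mem_curve hP hz]
      using eval_curvePoint hQ (sq_ne_of_mem_curve hP hz)
  rw [integrable_map_measure hf hmeas.aemeasurable, integral_map hmeas.aemeasurable hf,
    ← integral_congr_ae hae]
  exact ⟨(hint p).1.congr hae, (hint p).2⟩

theorem mul_self_div_pow_nonneg (q : ℝ[X]) (d t : ℝ) (k : ℕ) :
    0 ≤ (q * q).eval t / (t ^ 2 - d) ^ (2 * k) := by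
  rw [eval_mul]
  exact div_nonneg (mul_self_nonneg _) ((even_two_mul k).pow_nonneg _)

theorem IsMomentFunctional.apply_nonneg (hP : Irreducible (cubic a d e))
    (hL : IsMomentFunctional (curve a d e) L) {p : polyDeg (2 * k)} {q : ℝ[X]}
    (h : pullback a d e p = divPow d (2 * k) (q * q)) : 0 ≤ L p := by
  obtain ⟨ν, -, hν⟩ := hL.exists_measure hP
  rw [(hν p _ h).2]
  exact integral_nonneg fun t => mul_self_div_pow_nonneg q d t k

theorem IsMomentFunctional.exists_represents_atomic (hP : Irreducible (cubic a d e))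
    (hL : IsMomentFunctional (curve a d e) L) {p : polyDeg (2 * k)} {q : ℝ[X]} (hq : q ≠ 0)
    (h : pullback a d e p = divPow d (2 * k) (q * q)) (hp : L p = 0) :
    ∃ (S : Finset ℝ) (w : ℝ → ℝ), (∀ t ∈ S, 0 < w t) ∧ (∀ t ∈ S, t ^ 2 ≠ d) ∧
      (∀ t ∈ S, q.eval t = 0) ∧ Represents a d e L (atomic S w) := by
  obtain ⟨ν, hd, hν⟩ := hL.exists_measure hP
  let S := {t ∈ q.roots.toFinset | t ^ 2 ≠ d}
  let w : ℝ → ℝ := fun t => ν.real {t} / (t ^ 2 - d) ^ (2 * k)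
  have hroot {t : ℝ} (ht : t ∈ S) : q.eval t = 0 := by
    simp only [S, Finset.mem_filter, Multiset.mem_toFinset, mem_roots hq] at ht
    exact ht.1
  have hw (t : ℝ) : 0 ≤ w t := div_nonneg measureReal_nonneg ((even_two_mul k).pow_nonneg _)
  have hS : ∀ᵐ t ∂ν, t ∈ S := by
    rw [(hν p _ h).2, integral_eq_zero_iff_of_nonneg
      (fun t => mul_self_div_pow_nonneg q d t k) (hν p _ h).1] at hp
    filter_upwards [hd, hp] with t ht ht0
    have hpow := pow_ne_zero (2 * k) (sub_ne_zero.2 ht)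
    have hqt := (div_eq_zero_iff.1 ht0).resolve_right hpow
    rw [eval_mul, mul_self_eq_zero] at hqt
    simpa only [S, Finset.mem_filter, Multiset.mem_toFinset, mem_roots hq] using ⟨hqt, ht⟩
  refine ⟨{t ∈ S | 0 < w t}, w, fun t ht => (Finset.mem_filter.1 ht).2,
    fun t ht => (Finset.mem_filter.1 (Finset.mem_filter.1 ht).1).2,
    fun t ht => hroot (Finset.mem_filter.1 ht).1, fun r Q hQ => ?_⟩
  have hrestrict : ν.restrict S = ν := Measure.restrict_eq_self_of_ae_mem hS
  rw [(hν r Q hQ).2, ← setIntegral_univ, ← hrestrict, Measure.restrict_univ,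
    setIntegral_finset _ (hν r Q hQ).1.integrableOn, atomic_apply, Finset.sum_filter]
  refine Finset.sum_congr rfl fun t _ => ?_
  have hterm : ν.real {t} • (Q.eval t / (t ^ 2 - d) ^ (2 * k)) = w t * Q.eval t :=
    (mul_div_left_comm _ _ _).trans (mul_comm _ _)
  rw [hterm]
  split_ifs with hpos
  · rfl
  · rw [← (hw t).eq_of_not_lt hpos, zero_mul]

end Moments

/-! ### Positive extensions and moment functionals -/

section Conclusion

variable {a e δ : ℝ} {k : ℕ} {L : polyDeg (2 * k) →ₗ[ℝ] ℝ} {l l' : ℝ[X] →ₗ[ℝ] ℝ} {q r : ℝ[X]}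

theorem coordNumerators_two_mul (a e δ : ℝ) (k : ℕ) :
    coordNumerators a e δ (2 * k) (3 * (2 * k)) =
      nodeSpace δ (((num a e).eval δ ^ k) ^ 2) (((num a e).eval (-δ) ^ k) ^ 2) (2 * (3 * k)) := by
  rw [coordNumerators, mul_left_comm, ← pow_mul', ← pow_mul']

theorem mul_mem_coordNumerators (hq : q ∈ coordNumerators a e δ k (3 * k))
    (hr : r ∈ coordNumerators a e δ k (3 * k)) :
    q * r ∈ coordNumerators a e δ (2 * k) (3 * (2 * k)) :=
  coordNumerators_two_mul a e δ k ▸ mul_mem_nodeSpace_sq hq hr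

theorem mul_mem_coordNumerators_of_localNumerators (hq : q ∈ localNumerators a e δ k (3 * k))
    (hr : r ∈ localNumerators a e δ k (3 * k)) :
    q * r ∈ coordNumerators a e δ (2 * k) (3 * (2 * k)) :=
  coordNumerators_two_mul a e δ k ▸ mul_mem_nodeSpace_sq_of_neg hq hr

theorem mul_self_mem_coordNumerators
    (hq : q ∈ coordNumerators a e δ k (3 * k) ∨ q ∈ localNumerators a e δ k (3 * k)) :
    q * q ∈ coordNumerators a e δ (2 * k) (3 * (2 * k)) :=
  hq.elim (fun h => mul_mem_coordNumerators h h)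
    fun h => mul_mem_coordNumerators_of_localNumerators h h

theorem exists_pullback_eq_of_mem_coordNumerators (hP : Irreducible (cubic a (δ ^ 2) e))
    (hδ : δ ≠ 0) (hk : 1 ≤ k) (hq : q ∈ coordNumerators a e δ k (3 * k)) :
    ∃ p : polyDeg k, pullback a (δ ^ 2) e p = divPow (δ ^ 2) k q := by
  obtain ⟨-, ⟨p, rfl⟩, hp⟩ := (map_coordDeg hP hδ hk).ge (Submodule.mem_map_of_mem hq)
  exact ⟨p, hp⟩

theorem mem_coordNumerators_of_pullback_eq (hk : 1 ≤ k) {p : polyDeg k}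
    (h : pullback a (δ ^ 2) e p = divPow (δ ^ 2) k q) : q ∈ coordNumerators a e δ k (3 * k) := by
  have hp : toCoord (curve a (δ ^ 2) e) k p ∈ coordDeg (curve a (δ ^ 2) e) k :=
    LinearMap.mem_range_self _ p
  obtain ⟨r, hr, hrp⟩ := map_coordDeg_le a e δ hk (Submodule.mem_map_of_mem hp)
  exact divPow_injective _ _ (hrp.trans h) ▸ hr

theorem Represents.congr (hk : 1 ≤ k) (hl : Represents a (δ ^ 2) e L l)
    (h : ∀ Q ∈ coordNumerators a e δ (2 * k) (3 * (2 * k)), l' Q = l Q) :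
    Represents a (δ ^ 2) e L l' := fun p Q hQ =>
  (h Q (mem_coordNumerators_of_pullback_eq (by omega) hQ)).trans (hl p Q hQ)

theorem Represents.eqOn (hP : Irreducible (cubic a (δ ^ 2) e)) (hδ : δ ≠ 0) (hk : 1 ≤ k)
    (hl : Represents a (δ ^ 2) e L l) (hl' : Represents a (δ ^ 2) e L l') {Q : ℝ[X]}
    (hQ : Q ∈ coordNumerators a e δ (2 * k) (3 * (2 * k))) : l Q = l' Q := by
  obtain ⟨p, hp⟩ := exists_pullback_eq_of_mem_coordNumerators hP hδ (by omega) hQ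
  rw [hl p Q hp, hl' p Q hp]

theorem IsMomentFunctional.apply_mul_self_nonneg (hP : Irreducible (cubic a (δ ^ 2) e))
    (hδ : δ ≠ 0) (hk : 1 ≤ k) (hl : Represents a (δ ^ 2) e L l)
    (hmom : IsMomentFunctional (curve a (δ ^ 2) e) L)
    (hq : q * q ∈ coordNumerators a e δ (2 * k) (3 * (2 * k))) : 0 ≤ l (q * q) := by
  obtain ⟨p, hp⟩ := exists_pullback_eq_of_mem_coordNumerators hP hδ (by omega) hq
  rw [hl p _ hp]
  exact hmom.apply_nonneg hP hp

theorem IsMomentFunctional.isPos_coordForm (hP : Irreducible (cubic a (δ ^ 2) e)) (hδ : δ ≠ 0)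
    (hk : 1 ≤ k) (hL : VanishesOnIdeal (curve a (δ ^ 2) e) L)
    (hmom : IsMomentFunctional (curve a (δ ^ 2) e) L) :
    IsPos (coordForm (curve a (δ ^ 2) e) L hL) := by
  obtain ⟨l, hl⟩ := exists_represents hP hL
  exact (isPos_coordForm_iff hP hδ hk hl hL).2 fun q hq =>
    hmom.apply_mul_self_nonneg hP hδ hk hl (mul_mem_coordNumerators hq hq)

theorem IsMomentFunctional.isPos_localForm (hP : Irreducible (cubic a (δ ^ 2) e)) (hδ : δ ≠ 0)
    (hk : 1 ≤ k) (hL : VanishesOnIdeal (curve a (δ ^ 2) e) L)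
    (hmom : IsMomentFunctional (curve a (δ ^ 2) e) L) :
    IsPos (localForm a (δ ^ 2) e hk L hL) := by
  obtain ⟨l, hl⟩ := exists_represents hP hL
  exact (isPos_localForm_iff hP hδ hk hl hL).2 fun q hq =>
    hmom.apply_mul_self_nonneg hP hδ hk hl (mul_mem_coordNumerators_of_localNumerators hq hq)

theorem IsMomentFunctional.exists_represents_atomic_of_singular
    (hP : Irreducible (cubic a (δ ^ 2) e)) (hδ : δ ≠ 0) (hk : 1 ≤ k)
    (hL : VanishesOnIdeal (curve a (δ ^ 2) e) L)
    (hsing : ¬ IsNonsingular a (δ ^ 2) e hk L hL)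
    (hmom : IsMomentFunctional (curve a (δ ^ 2) e) L) :
    ∃ (S : Finset ℝ) (w : ℝ → ℝ) (q : ℝ[X]), (∀ t ∈ S, 0 < w t) ∧ δ ∉ S ∧ -δ ∉ S ∧
      (q ∈ coordNumerators a e δ k (3 * k) ∨ q ∈ localNumerators a e δ k (3 * k)) ∧ q ≠ 0 ∧
        (∀ t ∈ S, q.eval t = 0) ∧ Represents a (δ ^ 2) e L (atomic S w) := by
  obtain ⟨l, hl⟩ := exists_represents hP hL
  obtain ⟨q, hq, hq0, hqq⟩ := exists_ne_zero_of_singular hP hδ hk hl hL hsing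
  obtain ⟨p, hp⟩ := exists_pullback_eq_of_mem_coordNumerators hP hδ (by omega)
    (mul_self_mem_coordNumerators hq)
  obtain ⟨S, w, hw, hS, hqS, hlS⟩ :=
    hmom.exists_represents_atomic hP hq0 hp ((hl p _ hp).symm.trans hqq)
  exact ⟨S, w, q, hw, fun h => hS _ h rfl, fun h => hS _ h (neg_sq δ), hq, hq0, hqS, hlS⟩

theorem IsMomentFunctional.generatingNonvanishing (hP : Irreducible (cubic a (δ ^ 2) e))
    (hδ : 0 < δ) (hk : 1 ≤ k) (hL : VanishesOnIdeal (curve a (δ ^ 2) e) L)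
    (hsing : ¬ IsNonsingular a (δ ^ 2) e hk L hL)
    (hmom : IsMomentFunctional (curve a (δ ^ 2) e) L)
    {Lhat : rrSpace (δ ^ 2) (2 * k) →ₗ[ℝ] ℝ} (hext : IsExtension a (δ ^ 2) e L Lhat)
    (hpos : IsPos (rrForm (δ ^ 2) Lhat)) :
    GeneratingNonvanishing (δ ^ 2) (uniFunctional (δ ^ 2) Lhat) := by
  obtain ⟨S, w, q, hw, hδS, hδS', hq, hq0, hqS, hS⟩ :=
    hmom.exists_represents_atomic_of_singular hP hδ.ne' hk hL hsing
  obtain ⟨l, hl⟩ := exists_extend_uniFunctional Lhat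
  have hu := pow_ne_zero k (eval_num_ne_zero hP rfl)
  have hv := pow_ne_zero k (eval_num_ne_zero hP (neg_sq δ))
  have hqn : q ∈ uniDeg (3 * k) :=
    hq.elim (fun h => (mem_nodeSpace.1 h).1) fun h => (mem_nodeSpace.1 h).1
  have hatomic : ∀ Q ∈ uniDeg (2 * (3 * k)), l Q = atomic S w Q := by
    refine eq_atomic_of_eq_on_nodeSpace hδ.ne' hu hv (by omega) hδS hδS'
      ((isPos_rrForm_iff hl).1 hpos) (fun Q hQ => ?_) hqn
      (coordNumerators_two_mul a e δ k ▸ mul_self_mem_coordNumerators hq) hq0 hqS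
    rw [← coordNumerators_two_mul] at hQ
    exact ((isExtension_iff hl).1 hext).eqOn hP hδ.ne' hk hS hQ
  have hcard : S.card ≤ 3 * k := (card_le_natDegree hq0 hqS).trans (mem_uniDeg.1 hqn)
  refine (generatingNonvanishing_iff hl).2 ⟨_, isMinimalKernel_nodal hw hcard hatomic, ?_⟩
  rw [Real.sqrt_sq hδ.le]
  exact ⟨eval_nodal_id_ne_zero hδS, eval_nodal_id_ne_zero hδS'⟩

theorem IsMomentFunctional.rankCondition (hP : Irreducible (cubic a (δ ^ 2) e)) (hδ : δ ≠ 0)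
    (hk : 1 ≤ k) (hL : VanishesOnIdeal (curve a (δ ^ 2) e) L)
    (hsing : ¬ IsNonsingular a (δ ^ 2) e hk L hL)
    (hmom : IsMomentFunctional (curve a (δ ^ 2) e) L) : RankCondition a (δ ^ 2) e hk L hL := by
  obtain ⟨S, w, q, -, hδS, -, hq, hq0, hqS, hS⟩ :=
    hmom.exists_represents_atomic_of_singular hP hδ hk hL hsing
  have hv := pow_ne_zero k (eval_num_ne_zero hP (neg_sq δ))
  have hzero {r : ℝ[X]} (hr : ∀ t ∈ S, r.eval t = 0) (g : ℝ[X]) : atomic S w (r * g) = 0 :=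
    atomic_mul_eq_zero (fun t ht => by rw [hr t ht, mul_zero]) g
  rw [rankCondition_iff hP hδ hk hS hL (hmom.isPos_coordForm hP hδ hk hL)
    (hmom.isPos_localForm hP hδ hk hL)]
  obtain ⟨r, hr, hrn, hrS⟩ := exists_coeff_ne_zero_of_vanishing hδ hv hδS hq hq0 hqS
  exact hr.imp (fun h => ⟨r, ⟨h, fun g _ => hzero hrS g⟩, hrn⟩)
    fun h => ⟨r, ⟨h, fun g _ => hzero hrS g⟩, hrn⟩

theorem exists_isExtension_isPos_rrForm (hP : Irreducible (cubic a (δ ^ 2) e)) (hδ : δ ≠ 0)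
    (hk : 1 ≤ k) (hL : VanishesOnIdeal (curve a (δ ^ 2) e) L)
    (hcoord : IsPos (coordForm (curve a (δ ^ 2) e) L hL))
    (hlocal : IsPos (localForm a (δ ^ 2) e hk L hL)) :
    ∃ Lhat : rrSpace (δ ^ 2) (2 * k) →ₗ[ℝ] ℝ,
      IsExtension a (δ ^ 2) e L Lhat ∧ IsPos (rrForm (δ ^ 2) Lhat) := by
  obtain ⟨l, hl⟩ := exists_represents hP hL
  obtain ⟨l', hl', hpos⟩ := exists_isSquarePositive_uniDeg hδ
    (pow_ne_zero k (eval_num_ne_zero hP rfl)) (pow_ne_zero k (eval_num_ne_zero hP (neg_sq δ)))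
    (by omega) ((isPos_coordForm_iff hP hδ hk hl hL).1 hcoord)
    ((isPos_localForm_iff hP hδ hk hl hL).1 hlocal)
  obtain ⟨Lhat, hLhat⟩ := exists_uniFunctional_eq (δ ^ 2) k l'
  rw [← coordNumerators_two_mul] at hl'
  exact ⟨Lhat, (isExtension_iff hLhat).2 (hl.congr hk hl'), (isPos_rrForm_iff hLhat).2 hpos⟩

theorem isMomentFunctional_of_isExtension (hP : Irreducible (cubic a (δ ^ 2) e)) (hδ : 0 < δ)
    (hk : 1 ≤ k) (hL : VanishesOnIdeal (curve a (δ ^ 2) e) L)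
    {Lhat : rrSpace (δ ^ 2) (2 * k) →ₗ[ℝ] ℝ} (hext : IsExtension a (δ ^ 2) e L Lhat)
    (hpos : IsPos (rrForm (δ ^ 2) Lhat))
    (hgen : GeneratingNonvanishing (δ ^ 2) (uniFunctional (δ ^ 2) Lhat))
    (hcoord : IsPos (coordForm (curve a (δ ^ 2) e) L hL))
    (hlocal : IsPos (localForm a (δ ^ 2) e hk L hL))
    (hrank : RankCondition a (δ ^ 2) e hk L hL) : IsMomentFunctional (curve a (δ ^ 2) e) L := by
  obtain ⟨l, hl⟩ := exists_extend_uniFunctional Lhat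
  have hrep := (isExtension_iff hl).1 hext
  have hsq := (isPos_rrForm_iff hl).1 hpos
  obtain ⟨p, hp, hpδ, hpδ'⟩ := (generatingNonvanishing_iff hl).1 hgen
  rw [Real.sqrt_sq hδ.le] at hpδ hpδ'
  obtain ⟨q, hq, hqn⟩ : ∃ q, InKernel l (uniDeg (3 * k)) q ∧ q.coeff (3 * k) ≠ 0 := by
    rcases (rankCondition_iff hP hδ.ne' hk hrep hL hcoord hlocal).1 hrank with
      ⟨q, ⟨hq, hker⟩, hqn⟩ | ⟨q, ⟨hq, hker⟩, hqn⟩ <;>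
    exact ⟨q, hsq.inKernel (mem_nodeSpace.1 hq).1 (hker q hq), hqn⟩
  obtain ⟨w, hw, hatomic⟩ := hp.exists_quadrature hsq hq hqn
  refine isMomentFunctional_of_represents_atomic hw (fun t ht htδ => ?_)
    (hrep.congr hk fun Q hQ => (hatomic Q ?_).symm)
  · have hpt := isRoot_of_mem_roots (Multiset.mem_toFinset.1 ht)
    rcases sq_eq_sq_iff_eq_or_eq_neg.1 htδ with rfl | rfl
    exacts [hpδ hpt, hpδ' hpt]
  · rw [coordNumerators_two_mul] at hQ
    exact (mem_nodeSpace.1 hQ).1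

end Conclusion

end CubicTMP

end

theorem theorem4p6 (a d e : ℝ) (hd : 0 < d) (hP : Irreducible (CubicTMP.cubic a d e))
    (k : ℕ) (hk : 1 ≤ k) (L : CubicTMP.polyDeg (2 * k) →ₗ[ℝ] ℝ)
    (hL : CubicTMP.VanishesOnIdeal (CubicTMP.curve a d e) L)
    (hsing : ¬ CubicTMP.IsNonsingular a d e hk L hL) :
    List.TFAE [
      CubicTMP.IsMomentFunctional (CubicTMP.curve a d e) L,
      CubicTMP.IsPos (CubicTMP.coordForm (CubicTMP.curve a d e) L hL) ∧
        CubicTMP.IsPos (CubicTMP.localForm a d e hk L hL) ∧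
        (∃ Lhat : CubicTMP.rrSpace d (2 * k) →ₗ[ℝ] ℝ,
          CubicTMP.IsExtension a d e L Lhat ∧ CubicTMP.IsPos (CubicTMP.rrForm d Lhat) ∧
            CubicTMP.GeneratingNonvanishing d (CubicTMP.uniFunctional d Lhat)) ∧
        CubicTMP.RankCondition a d e hk L hL,
      CubicTMP.IsPos (CubicTMP.coordForm (CubicTMP.curve a d e) L hL) ∧
        CubicTMP.IsPos (CubicTMP.localForm a d e hk L hL) ∧
        (∀ Lhat : CubicTMP.rrSpace d (2 * k) →ₗ[ℝ] ℝ,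
          CubicTMP.IsExtension a d e L Lhat → CubicTMP.IsPos (CubicTMP.rrForm d Lhat) →
            CubicTMP.GeneratingNonvanishing d (CubicTMP.uniFunctional d Lhat)) ∧
        CubicTMP.RankCondition a d e hk L hL] := by
  obtain ⟨δ, hδ, rfl⟩ : ∃ δ, 0 < δ ∧ δ ^ 2 = d := ⟨√d, Real.sqrt_pos.2 hd, Real.sq_sqrt hd.le⟩
  tfae_have 1 → 3 := fun hmom =>
    ⟨hmom.isPos_coordForm hP hδ.ne' hk hL, hmom.isPos_localForm hP hδ.ne' hk hL,
      fun _ hext hpos => hmom.generatingNonvanishing hP hδ hk hL hsing hext hpos,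
      hmom.rankCondition hP hδ.ne' hk hL hsing⟩
  tfae_have 3 → 2 := by
    rintro ⟨hcoord, hlocal, hgen, hrank⟩
    obtain ⟨Lhat, hext, hpos⟩ :=
      CubicTMP.exists_isExtension_isPos_rrForm hP hδ.ne' hk hL hcoord hlocal
    exact ⟨hcoord, hlocal, ⟨Lhat, hext, hpos, hgen Lhat hext hpos⟩, hrank⟩
  tfae_have 2 → 1 := fun ⟨hcoord, hlocal, ⟨_, hext, hpos, hgen⟩, hrank⟩ =>
    CubicTMP.isMomentFunctional_of_isExtension hP hδ hk hL hext hpos hgen hcoord hlocal hrank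
  tfae_finish
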